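/- Multigraphs are finite and loopless, but may have parallel edges; the multiplicity of an edge is the number of edges that join the same two vertices (including itself). A drawing of a multigraph maps the vertices to distinct points of the plane and the edges to simple curves joining the images of their endpoints, such that no edge goes through the image of a vertex that is not one of its endpoints, no three edges share a point other than the image of a vertex, and no two edges have infinitely many common points. The number of crossings of a drawing is the number of intersection points between pairs of distinct edges, images of vertices not counted. The crossing number $cr(G)$ is the minimum number of crossings over all drawings of $G$. Let $cr(n,m)$ be the minimum of $cr(G)$ over all simple graphs $G$ with $n$ vertices and $m$ edges, and let $cr(n,m,k)$ be the minimum of $cr(G)$ over all multigraphs $G$ with $n$ vertices and $m$ edges, each of multiplicity at most $k$; the minimum over an empty family is $\infty$ (and $0\cdot\infty=0$). Write $\{x\}=x-\lfloor x\rfloor$. For all integers $n,m\ge 0$ and $k\ge 1$: (1) $k^2\cdot cr\left(n,\left\lfloor\frac{m}{k}\right\rfloor\right)\le cr(n,m,k)\le k^2\cdot cr\left(n,\left\lceil\frac{m}{k}\right\rceil\right)$; (2) $cr(n,m,k)\ge k^2\cdot\left(\left(1-\left\{\frac{m}{k}\right\}\right)\cdot cr\left(n,\left\lfloor\frac{m}{k}\right\rfloor\right)+\left\{\frac{m}{k}\right\}\cdot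 cr\left(n,\left\lceil\frac{m}{k}\right\rceil\right)\right)$. -/

import Mathlib

open scoped ENNReal

/-- The Euclidean plane. -/
abbrev Plane : Type := EuclideanSpace ℝ (Fin 2)

/-- A drawing in the plane of a multigraph `G` (Mathlib's `Graph`, with vertex set `V(G)`, edge set
`E(G)` and `G.IsLink e x y` meaning that `e` joins `x` and `y`): the vertices are distinct points,
and the edges are simple curves joining the images of their ends, which contain no image of another
vertex. No three edges share a point that is not a vertex, and no two edges share infinitely many
points. (A loop cannot be drawn by such a curve; all graphs considered below are loopless.) The
values of `point` and `curve` outside `V(G)` and `E(G)` play no role. -/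
structure Graph.Drawing {α β : Type*} (G : Graph α β) where
  /-- The image of a vertex. -/
  point : α → Plane
  /-- The curve that represents an edge. -/
  curve : β → C(unitInterval, Plane)
  point_injOn : Set.InjOn point G.vertexSet
  curve_injective : ∀ e ∈ G.edgeSet, Function.Injective (curve e)
  curve_ends : ∀ e ∈ G.edgeSet, ∃ x y, G.IsLink e x y ∧ curve e 0 = point x ∧ curve e 1 = point y
  inc_of_point_mem : ∀ e ∈ G.edgeSet, ∀ v ∈ G.vertexSet,
    point v ∈ Set.range (curve e) → G.Inc e v
  no_three : ∀ e ∈ G.edgeSet, ∀ f ∈ G.edgeSet, ∀ g ∈ G.edgeSet, e ≠ f → e ≠ g → f ≠ g →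
    Set.range (curve e) ∩ Set.range (curve f) ∩ Set.range (curve g) ⊆ point '' G.vertexSet
  finite_inter : ∀ e ∈ G.edgeSet, ∀ f ∈ G.edgeSet, e ≠ f →
    (Set.range (curve e) ∩ Set.range (curve f)).Finite

/-- The crossings of a drawing: all pairs that consist of an unordered pair of distinct edges and a
common point of their curves that is not (the image of) a vertex. -/
def Graph.Drawing.crossings {α β : Type*} {G : Graph α β} (D : G.Drawing) :
    Set (Sym2 β × Plane) :=
  {x | ∃ e ∈ G.edgeSet, ∃ f ∈ G.edgeSet, e ≠ f ∧ x.1 = s(e, f) ∧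
    x.2 ∈ Set.range (D.curve e) ∧ x.2 ∈ Set.range (D.curve f) ∧ x.2 ∉ D.point '' G.vertexSet}

/-- The crossing number of a graph: the least number of crossings in a drawing of it. -/
noncomputable def Graph.crossingNumber {α β : Type*} (G : Graph α β) : ℕ∞ :=
  ⨅ D : G.Drawing, D.crossings.encard

/-- Every edge of `G` has multiplicity at most `k`: no two vertices are joined by more than `k`
edges. -/
def Graph.MultiplicityLE {α β : Type*} (G : Graph α β) (k : ℕ) : Prop :=
  ∀ x y, {e | G.IsLink e x y}.encard ≤ k

/-- `crSimple n m` is the minimum of the crossing number over all simple graphs with `n` vertices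
and `m` edges (`⊤` if there are none). Every finite graph is isomorphic to one whose vertices and
edges are named by natural numbers, so it suffices to consider these. -/
noncomputable def crSimple (n m : ℕ) : ℕ∞ :=
  ⨅ G : {G : Graph ℕ ℕ // G.vertexSet.encard = n ∧ G.edgeSet.encard = m ∧ G.Simple},
    G.1.crossingNumber

/-- `crMulti n m k` is the minimum of the crossing number over all loopless multigraphs with `n`
vertices and `m` edges, each of multiplicity at most `k` (`⊤` if there are none). -/
noncomputable def crMulti (n m k : ℕ) : ℕ∞ :=
  ⨅ G : {G : Graph ℕ ℕ // G.vertexSet.encard = n ∧ G.edgeSet.encard = m ∧ G.Loopless ∧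
    G.MultiplicityLE k}, G.1.crossingNumber

/-! Upper bound in (1). Take a best drawing of a simple graph with `⌈m/k⌉` edges and draw up to `k`
copies of each edge close along it, `m` copies in all. Copies of one edge do not cross, and copies
of two different edges cross only near crossings of the originals, at most once near each, so every
crossing yields at most `k²` crossings. Since the curves are merely continuous, the drawing is first
made polygonal without new crossings (`ArcSystem.exists_polygonalSystem`): near each vertex and each
common point the curves are replaced by chords or radii of a small disk, and then each curve by a
shortest path among its points with hops shorter than `δ`, which is automatically a simple polygonal
line. Polygonal lines are copied by moving their corners slightly (`PolygonalSystem.exists_copies`);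
`Graph.Drawing.exists_copies` does the counting.

Lower bound (2). In a drawing of a multigraph, give every edge the weight `1/k` and consider the sum
of `p e * p f` over all crossings of edges `e` and `f`, which is the number of crossings divided by
`k²`. No crossing pairs an edge with itself, so this sum is a concave function of the weight moved
from one edge to another, and one of the two directions does not increase it. Such moves, made
between parallel edges where possible, keep the total weight of parallel edges at most 1 and end
with at most one weight strictly between 0 and 1. The total is still `m/k`; so the edges of weight 1
are `⌊m/k⌋` in number, and `⌈m/k⌉` together with the fractional edge, if there is one. Both sets
contain no parallel edges, and the final sum interpolates linearly between their numbers of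
crossings (`IsClassWeight.exists_rounding`). The lower bound in (1) follows because `crSimple` is
monotone in the number of edges. -/

open Filter Topology

/-! ### Plane vectors, and segments under small perturbations -/

/-- The determinant of two vectors of the plane. -/
def Plane.cross (v w : Plane) : ℝ := v 0 * w 1 - v 1 * w 0

/-- The rotation of the plane by a right angle. -/
noncomputable def Plane.rot (v : Plane) : Plane := !₂[-v 1, v 0]

namespace Plane

lemma inner_eq (v w : Plane) : inner ℝ v w = v 0 * w 0 + v 1 * w 1 := by
  simp [PiLp.inner_apply, Fin.sum_univ_two, mul_comm]

lemma cross_rot (v m : Plane) : cross v (rot m) = inner ℝ m v := by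
  simp [cross, rot, inner_eq]; ring

lemma inner_rot_self (m : Plane) : inner ℝ m (rot m) = 0 := by
  simp [rot, inner_eq]; ring

@[simp] lemma cross_add_right (v w u : Plane) : cross v (w + u) = cross v w + cross v u := by
  simp [cross]; ring

@[simp] lemma cross_smul_right (v w : Plane) (c : ℝ) : cross v (c • w) = c * cross v w := by
  simp [cross]; ring

@[simp] lemma cross_smul_left (v w : Plane) (c : ℝ) : cross (c • v) w = c * cross v w := by
  simp [cross]; ring

@[simp] lemma cross_self (v : Plane) : cross v v = 0 := by
  simp [cross]; ring

@[fun_prop] lemma continuous_cross {X : Type*} [TopologicalSpace X] {f g : X → Plane}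
    (hf : Continuous f) (hg : Continuous g) : Continuous fun x => cross (f x) (g x) := by
  unfold cross; fun_prop

lemma eq_smul_of_cross_eq_zero {v w : Plane} (hv : v ≠ 0) (h : cross v w = 0) :
    w = (inner ℝ v w / inner ℝ v v) • v := by
  have hvv : inner ℝ v v ≠ 0 := by simpa using hv
  have h' : v 0 * w 1 = v 1 * w 0 := by unfold cross at h; linarith
  ext i
  rw [PiLp.smul_apply, smul_eq_mul, div_mul_eq_mul_div, eq_div_iff hvv, inner_eq, inner_eq]
  fin_cases i
  · simp only [Fin.zero_eta]; linear_combination (v 1) * h'.symm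
  · simp only [Fin.mk_one]; linear_combination (v 0) * h'

lemma mem_segment_iff {a b x : Plane} :
    x ∈ segment ℝ a b ↔ ∃ t : ℝ, 0 ≤ t ∧ t ≤ 1 ∧ x = a + t • (b - a) := by
  rw [segment_eq_image']
  constructor
  · rintro ⟨t, ht, rfl⟩; exact ⟨t, ht.1, ht.2, rfl⟩
  · rintro ⟨t, h0, h1, rfl⟩; exact ⟨t, ⟨h0, h1⟩, rfl⟩

lemma segment_inter_subsingleton {a b c d : Plane} (h : cross (b - a) (d - c) ≠ 0) :
    (segment ℝ a b ∩ segment ℝ c d).Subsingleton := by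
  rintro x ⟨hx, hx'⟩ y ⟨hy, hy'⟩
  obtain ⟨t, -, -, ht⟩ := mem_segment_iff.1 hx
  obtain ⟨t', -, -, ht'⟩ := mem_segment_iff.1 hx'
  obtain ⟨s, -, -, hs⟩ := mem_segment_iff.1 hy
  obtain ⟨s', -, -, hs'⟩ := mem_segment_iff.1 hy'
  have e1 : (t - s) • (b - a) = (t' - s') • (d - c) := by
    have : x - y = (t - s) • (b - a) := by rw [ht, hs]; module
    rw [← this, ht', hs']; module
  have e2 : (t - s) * cross (b - a) (d - c) = 0 := by
    rw [← cross_smul_left, e1, cross_smul_left, cross_self, mul_zero]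
  have e3 : t = s := by
    have := (mul_eq_zero.1 e2).resolve_right h; linarith
  rw [ht, hs, e3]

/-- The two vectors are not on a common ray. -/
def Spread (v w : Plane) : Prop := cross v w ≠ 0 ∨ inner ℝ v w < 0

lemma Spread.segment_inter {o a b : Plane} (h : Spread (a - o) (b - o)) :
    segment ℝ o a ∩ segment ℝ o b ⊆ {o} := by
  rintro x ⟨hx, hx'⟩
  obtain ⟨t, t0, -, ht⟩ := mem_segment_iff.1 hx
  obtain ⟨s, s0, -, hs⟩ := mem_segment_iff.1 hx'
  have e : t • (a - o) = s • (b - o) := by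
    rw [ht] at hs; exact add_left_cancel hs
  have key : t = 0 := by
    rcases h with h | h
    · have : t * cross (a - o) (b - o) = 0 := by
        rw [← cross_smul_left, e, cross_smul_left, cross_self, mul_zero]
      exact (mul_eq_zero.1 this).resolve_right h
    · have h1 : t * inner ℝ (a - o) (b - o) = s * inner ℝ (b - o) (b - o) := by
        have := congrArg (fun z => inner ℝ z (b - o)) e
        simpa only [real_inner_smul_left] using this
      have h2 : 0 ≤ s * inner ℝ (b - o) (b - o) := mul_nonneg s0 real_inner_self_nonneg
      nlinarith
  simp [ht, key]

lemma spread_of_segment_inter {o a b : Plane} (ha : a ≠ o) (hb : b ≠ o)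
    (h : segment ℝ o a ∩ segment ℝ o b ⊆ {o}) : Spread (a - o) (b - o) := by
  by_contra hn
  simp only [Spread, not_or, not_not, not_lt] at hn
  obtain ⟨h1, h2⟩ := hn
  have ha' : a - o ≠ 0 := sub_ne_zero.2 ha
  have e := eq_smul_of_cross_eq_zero ha' h1
  have hpos : 0 < inner ℝ (a - o) (a - o) := real_inner_self_pos.2 ha'
  set c := inner ℝ (a - o) (b - o) / inner ℝ (a - o) (a - o)
  have hc : 0 ≤ c := div_nonneg h2 hpos.le
  have hc' : 0 < c := by
    refine lt_of_le_of_ne hc fun h0 => ?_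
    rw [← h0, zero_smul, sub_eq_zero] at e
    exact hb e
  rcases le_total c 1 with h' | h'
  · have : b ∈ segment ℝ o a ∩ segment ℝ o b := by
      refine ⟨mem_segment_iff.2 ⟨c, hc, h', ?_⟩, right_mem_segment _ _ _⟩
      rw [← e]; simp
    exact hb (h this)
  · have : a ∈ segment ℝ o a ∩ segment ℝ o b := by
      refine ⟨right_mem_segment _ _ _, mem_segment_iff.2 ⟨c⁻¹, by positivity, inv_le_one_of_one_le₀ h', ?_⟩⟩
      rw [e, smul_smul, inv_mul_cancel₀ hc'.ne']; simp
    exact ha (h this)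

/-- Both alternatives in `Spread` are open conditions; this is what keeps two sides at a common
vertex apart under perturbation. -/
lemma Spread.eventually {f g : ℝ → Plane} (hf : Continuous f) (hg : Continuous g)
    (h : Spread (f 0) (g 0)) : ∀ᶠ ε in 𝓝 (0 : ℝ), Spread (f ε) (g ε) := by
  rcases h with h | h
  · have : Continuous fun ε => cross (f ε) (g ε) := by fun_prop
    exact (this.continuousAt.eventually_ne h).mono fun _ => Or.inl
  · have : Continuous fun ε => inner ℝ (f ε) (g ε) := by fun_prop
    exact (this.continuousAt.eventually_lt continuousAt_const h).mono fun _ => Or.inr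

/-- The coincidences of three points on the moving segments form a closed set `F` in the space of
`ε` and three parameters. The parameters range over a compact cube, so if the fibre over `0` is
empty, then so are the nearby ones. -/
lemma eventually_segment_inter_eq_empty₃ {a b c d p q : ℝ → Plane} (ha : Continuous a)
    (hb : Continuous b) (hc : Continuous c) (hd : Continuous d) (hp : Continuous p)
    (hq : Continuous q)
    (h : segment ℝ (a 0) (b 0) ∩ segment ℝ (c 0) (d 0) ∩ segment ℝ (p 0) (q 0) = ∅) :
    ∀ᶠ ε in 𝓝 (0 : ℝ),
      segment ℝ (a ε) (b ε) ∩ segment ℝ (c ε) (d ε) ∩ segment ℝ (p ε) (q ε) = ∅ := by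
  have hK : IsCompact (Set.Icc (0 : ℝ) 1 ×ˢ Set.Icc (0 : ℝ) 1 ×ˢ Set.Icc (0 : ℝ) 1) :=
    isCompact_Icc.prod (isCompact_Icc.prod isCompact_Icc)
  let F : Set (ℝ × ℝ × ℝ × ℝ) := {z |
    a z.1 + z.2.1 • (b z.1 - a z.1) = c z.1 + z.2.2.1 • (d z.1 - c z.1) ∧
    a z.1 + z.2.1 • (b z.1 - a z.1) = p z.1 + z.2.2.2 • (q z.1 - p z.1)}
  have hF : IsClosed F := by
    apply IsClosed.inter
    · exact isClosed_eq (by fun_prop) (by fun_prop)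
    · exact isClosed_eq (by fun_prop) (by fun_prop)
  have := hK.eventually_forall_of_forall_eventually (x₀ := (0 : ℝ)) (P := fun ε t => (ε, t) ∉ F) ?_
  · filter_upwards [this] with ε hε
    rw [Set.eq_empty_iff_forall_notMem]
    rintro x ⟨⟨h1, h2⟩, h3⟩
    obtain ⟨t, t0, t1, ht⟩ := mem_segment_iff.1 h1
    obtain ⟨s, s0, s1, hs⟩ := mem_segment_iff.1 h2
    obtain ⟨r, r0, r1, hr⟩ := mem_segment_iff.1 h3
    exact hε (t, s, r) ⟨⟨t0, t1⟩, ⟨s0, s1⟩, ⟨r0, r1⟩⟩ ⟨ht.symm.trans hs, ht.symm.trans hr⟩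
  · rintro ⟨t, s, r⟩ ⟨⟨t0, t1⟩, ⟨s0, s1⟩, ⟨r0, r1⟩⟩
    refine hF.isOpen_compl.eventually_mem ?_
    rintro ⟨h1, h2⟩
    have hmem : a 0 + t • (b 0 - a 0) ∈
        segment ℝ (a 0) (b 0) ∩ segment ℝ (c 0) (d 0) ∩ segment ℝ (p 0) (q 0) :=
      ⟨⟨mem_segment_iff.2 ⟨t, t0, t1, rfl⟩, mem_segment_iff.2 ⟨s, s0, s1, h1⟩⟩,
        mem_segment_iff.2 ⟨r, r0, r1, h2⟩⟩
    rw [h] at hmem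
    exact hmem

lemma eventually_disjoint_segment {a b c d : ℝ → Plane} (ha : Continuous a)
    (hb : Continuous b) (hc : Continuous c) (hd : Continuous d)
    (h : Disjoint (segment ℝ (a 0) (b 0)) (segment ℝ (c 0) (d 0))) :
    ∀ᶠ ε in 𝓝 (0 : ℝ), Disjoint (segment ℝ (a ε) (b ε)) (segment ℝ (c ε) (d ε)) := by
  have h' : segment ℝ (a 0) (b 0) ∩ segment ℝ (c 0) (d 0) ∩ segment ℝ (c 0) (d 0) = ∅ := by
    rw [Set.inter_assoc, Set.inter_self]; exact h.inter_eq
  filter_upwards [eventually_segment_inter_eq_empty₃ ha hb hc hd hc hd h'] with ε hε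
  rw [Set.inter_assoc, Set.inter_self] at hε
  exact Set.disjoint_iff_inter_eq_empty.2 hε

lemma eventually_notMem_segment {a b : ℝ → Plane} (ha : Continuous a)
    (hb : Continuous b) (v : Plane) (h : v ∉ segment ℝ (a 0) (b 0)) :
    ∀ᶠ ε in 𝓝 (0 : ℝ), v ∉ segment ℝ (a ε) (b ε) := by
  have := eventually_disjoint_segment (c := fun _ => v) (d := fun _ => v) ha hb continuous_const
    continuous_const (by simpa using h)
  simpa using this

/-- A vector that has positive inner products with two vectors that are not antiparallel. -/
lemma exists_inner_pos {v w : Plane} (hv : v ≠ 0) (hw : w ≠ 0) (h : Spread (-v) w) :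
    ∃ m : Plane, 0 < inner ℝ m v ∧ 0 < inner ℝ m w := by
  -- Strict Cauchy-Schwarz: by Lagrange's identity, equality would force `cross v w = 0` with a
  -- negative inner product, so `v` and `w` would be antiparallel.
  have hlt : -(‖v‖ * ‖w‖) < inner ℝ v w := by
    refine lt_of_le_of_ne (neg_le_of_abs_le (abs_real_inner_le_norm v w)) fun heq => ?_
    have h1 : (v 0 * w 0 + v 1 * w 1) ^ 2 = inner ℝ v v * inner ℝ w w := by
      rw [← inner_eq, ← heq, real_inner_self_eq_norm_sq, real_inner_self_eq_norm_sq]; ring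
    have h2 : cross v w ^ 2 = 0 := by
      rw [inner_eq, inner_eq] at h1; unfold cross; linear_combination -h1
    rcases h with h | h
    · apply h
      have : cross (-v) w = - cross v w := by simp [cross]; ring
      rw [this, pow_eq_zero_iff two_ne_zero |>.1 h2, neg_zero]
    · rw [inner_neg_left, ← heq] at h
      have : 0 < ‖v‖ * ‖w‖ := mul_pos (norm_pos_iff.2 hv) (norm_pos_iff.2 hw)
      linarith
  have hv' := norm_pos_iff.2 hv
  have hw' := norm_pos_iff.2 hw
  -- The direction of the angle bisector of `v` and `w`.
  refine ⟨‖w‖ • v + ‖v‖ • w, ?_, ?_⟩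
  · rw [inner_add_left, real_inner_smul_left, real_inner_smul_left, real_inner_self_eq_norm_sq,
      real_inner_comm]
    nlinarith
  · rw [inner_add_left, real_inner_smul_left, real_inner_smul_left, real_inner_self_eq_norm_sq]
    nlinarith

end Plane

/-! ### Polygonal lines and their parametrization -/

/-- A polygonal line with `len` sides, given by its successive corners `pt 0, …, pt len`. -/
structure Polyline where
  /-- The number of sides. -/
  len : ℕ
  /-- The corners. -/
  pt : ℕ → Plane

namespace Polyline

variable (P : Polyline)

/-- The `i`-th side of a polygonal line. -/
def side (i : ℕ) : Set Plane := segment ℝ (P.pt i) (P.pt (i + 1))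

/-- The union of the sides of a polygonal line. -/
def carrier : Set Plane := {x | ∃ i < P.len, x ∈ P.side i}

/-- The polygonal line has at least two sides, and does not intersect itself. -/
structure IsSimple : Prop where
  two_le : 2 ≤ P.len
  ne : ∀ i < P.len, P.pt i ≠ P.pt (i + 1)
  disjoint : ∀ i j, i + 1 < j → j < P.len → Disjoint (P.side i) (P.side j)
  adjacent : ∀ i, i + 1 < P.len → P.side i ∩ P.side (i + 1) ⊆ {P.pt (i + 1)}

variable {P}

lemma IsSimple.eq_zero_of_mem_side (hP : P.IsSimple) {i : ℕ} (hi : i < P.len)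
    (h : P.pt 0 ∈ P.side i) : i = 0 := by
  have h0 : P.pt 0 ∈ P.side 0 := left_mem_segment _ _ _
  rcases Nat.lt_trichotomy i 1 with h1 | rfl | h1
  · omega
  · exact absurd (hP.adjacent 0 hi ⟨h0, h⟩) (hP.ne 0 (by omega))
  · exact absurd h (Set.disjoint_left.1 (hP.disjoint 0 i (by omega) hi) h0)

lemma IsSimple.eq_of_last_mem_side (hP : P.IsSimple) {i : ℕ} (hi : i < P.len)
    (h : P.pt P.len ∈ P.side i) : i + 1 = P.len := by
  obtain ⟨N, hN⟩ : ∃ N, P.len = N + 1 := ⟨P.len - 1, by have := hP.two_le; omega⟩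
  have h0 : P.pt P.len ∈ P.side N := by rw [hN]; exact right_mem_segment _ _ _
  rcases Nat.lt_trichotomy (i + 1) N with h1 | h1 | h1
  · exact absurd h0 (Set.disjoint_left.1 (hP.disjoint i N h1 (by omega)) h)
  · have := hP.adjacent i (by omega) ⟨h, h1 ▸ h0⟩
    rw [Set.mem_singleton_iff, h1, hN] at this
    exact absurd this.symm (hP.ne N (by omega))
  · omega

lemma IsSimple.side_unique (hP : P.IsSimple) {i j : ℕ} (hi : i < P.len) (hj : j < P.len)
    {x : Plane} (hx : x ∈ P.side i) (hx' : x ∈ P.side j) (hne : ∀ l ≤ P.len, x ≠ P.pt l) :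
    i = j := by
  wlog hij : i ≤ j generalizing i j
  · exact (this hj hi hx' hx (by omega)).symm
  rcases Nat.lt_trichotomy (i + 1) j with h1 | rfl | h1
  · exact absurd hx' (Set.disjoint_left.1 (hP.disjoint i j h1 hj) hx)
  · exact absurd (hP.adjacent i hj ⟨hx, hx'⟩) (hne _ (by omega))
  · omega

variable (P)

/-- The parametrization of a polygonal line by the interval `[0, len]`. -/
noncomputable def param (x : ℝ) : Plane :=
  P.pt 0 + ∑ i ∈ Finset.range P.len, max 0 (min (x - i) 1) • (P.pt (i + 1) - P.pt i)

lemma continuous_param : Continuous P.param := by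
  unfold param; fun_prop

lemma param_eq {j : ℕ} (hj : j < P.len) {x : ℝ} (h1 : j ≤ x) (h2 : x ≤ j + 1) :
    P.param x = P.pt j + (x - j) • (P.pt (j + 1) - P.pt j) := by
  have hsub : Finset.range (j + 1) ⊆ Finset.range P.len := by
    intro i; simp only [Finset.mem_range]; omega
  rw [param, ← Finset.sum_subset hsub, Finset.sum_range_succ]
  · have : ∑ i ∈ Finset.range j, max 0 (min (x - i) 1) • (P.pt (i + 1) - P.pt i) =
        ∑ i ∈ Finset.range j, (P.pt (i + 1) - P.pt i) := by
      refine Finset.sum_congr rfl fun i hi => ?_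
      have hi' : (i : ℝ) + 1 ≤ j := by exact_mod_cast Finset.mem_range.1 hi
      rw [min_eq_right (by linarith), max_eq_right zero_le_one, one_smul]
    rw [this, Finset.sum_range_sub, min_eq_left (by linarith), max_eq_right (by linarith)]
    abel
  · intro i _ hi
    have hi' : (j : ℝ) + 1 ≤ i := by
      have : j + 1 ≤ i := by simpa using hi
      exact_mod_cast this
    rw [max_eq_left (min_le_of_left_le (by linarith)), zero_smul]

lemma param_mem_side {j : ℕ} (hj : j < P.len) {x : ℝ} (h1 : j ≤ x) (h2 : x ≤ j + 1) :
    P.param x ∈ P.side j :=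
  Plane.mem_segment_iff.2 ⟨x - j, by linarith, by linarith, P.param_eq hj h1 h2⟩

lemma param_zero : P.param 0 = P.pt 0 := by
  rw [param, Finset.sum_eq_zero, add_zero]
  intro i _
  rw [max_eq_left (min_le_of_left_le (by simp)), zero_smul]

lemma param_len : P.param P.len = P.pt P.len := by
  rcases Nat.eq_zero_or_pos P.len with h | h
  · rw [h, Nat.cast_zero, param_zero]
  · obtain ⟨N, hN⟩ : ∃ N, P.len = N + 1 := ⟨P.len - 1, by omega⟩
    rw [P.param_eq (j := N) (by omega) (by rw [hN]; push_cast; linarith)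
      (by rw [hN]; push_cast; linarith), hN]
    push_cast
    simp

/-- A polygonal line as a curve that is parametrized by the unit interval. -/
noncomputable def curve : C(unitInterval, Plane) where
  toFun t := P.param (P.len * t)
  continuous_toFun := P.continuous_param.comp (by fun_prop)

lemma curve_zero : P.curve 0 = P.pt 0 := by
  simp [curve, param_zero]

lemma curve_one : P.curve 1 = P.pt P.len := by
  simp [curve, param_len]

variable {P}

lemma exists_floor {N : ℕ} {x : ℝ} (h0 : 0 ≤ x) (h1 : x < N) :
    ∃ i < N, (i : ℝ) ≤ x ∧ x < i + 1 :=
  ⟨⌊x⌋₊, (Nat.floor_lt h0).2 h1, Nat.floor_le h0, Nat.lt_floor_add_one x⟩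

lemma exists_ceil {N : ℕ} {x : ℝ} (h0 : 0 < x) (h1 : x ≤ N) :
    ∃ i < N, (i : ℝ) < x ∧ x ≤ i + 1 := by
  have hpos : 0 < ⌈x⌉₊ := Nat.ceil_pos.2 h0
  obtain ⟨i, hi⟩ : ∃ i, ⌈x⌉₊ = i + 1 := ⟨⌈x⌉₊ - 1, by omega⟩
  have hN := Nat.ceil_le.2 h1
  refine ⟨i, by omega, Nat.lt_ceil.1 (by omega), ?_⟩
  have := Nat.le_ceil x
  rw [hi] at this
  exact_mod_cast this

/-- Rounding `x` down and `y` up places them in `[i, i + 1)` and `(j, j + 1]` with `i ≤ j`. The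
half-open ends exclude the common corner of two adjacent sides. -/
lemma IsSimple.param_ne (hP : P.IsSimple) {x y : ℝ} (hx : 0 ≤ x) (hxy : x < y) (hy : y ≤ P.len) :
    P.param x ≠ P.param y := by
  obtain ⟨i, hi, hix, hxi⟩ := exists_floor hx (hxy.trans_le hy)
  obtain ⟨j, hj, hjy, hyj⟩ := exists_ceil (hx.trans_lt hxy) hy
  have hij : i ≤ j := by
    have : (i : ℝ) < j + 1 := by linarith
    have : i < j + 1 := by exact_mod_cast this
    omega
  have hxs := P.param_mem_side hi hix hxi.le
  have hys := P.param_mem_side hj hjy.le hyj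
  intro heq
  have hne := sub_ne_zero.2 (hP.ne i hi).symm
  have hinj : ∀ s t : ℝ, P.pt i + s • (P.pt (i + 1) - P.pt i) =
      P.pt i + t • (P.pt (i + 1) - P.pt i) → s = t := fun s t h =>
    smul_left_injective ℝ hne (add_left_cancel h)
  rcases Nat.lt_trichotomy (i + 1) j with h1 | rfl | h1
  · exact Set.disjoint_left.1 (hP.disjoint i j h1 hj) hxs (heq ▸ hys)
  · have := hP.adjacent i hj ⟨hxs, heq ▸ hys⟩
    rw [Set.mem_singleton_iff, P.param_eq hi hix hxi.le] at this
    have h3 := hinj (x - i) 1 (by rw [this]; simp)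
    linarith
  · obtain rfl : i = j := by omega
    rw [P.param_eq hi hix hxi.le, P.param_eq hi hjy.le hyj] at heq
    have := hinj _ _ heq
    linarith

lemma IsSimple.curve_injective (hP : P.IsSimple) : Function.Injective P.curve := by
  have hpos : (0 : ℝ) < P.len := by
    have := hP.two_le
    exact_mod_cast (by omega : 0 < P.len)
  have key : ∀ s t : unitInterval, s < t → P.curve s ≠ P.curve t := fun s t h =>
    hP.param_ne (mul_nonneg hpos.le s.2.1) (mul_lt_mul_of_pos_left h hpos)
      (mul_le_of_le_one_right hpos.le t.2.2)
  intro s t h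
  rcases lt_trichotomy s t with h' | h' | h'
  · exact absurd h (key s t h')
  · exact h'
  · exact absurd h.symm (key t s h')

lemma IsSimple.range_curve (hP : P.IsSimple) : Set.range P.curve = P.carrier := by
  have hN := hP.two_le
  have hpos : (0 : ℝ) < P.len := by exact_mod_cast (by omega : 0 < P.len)
  ext x
  constructor
  · rintro ⟨t, rfl⟩
    rcases t.2.2.lt_or_eq with h | h
    · obtain ⟨i, hi, h1, h2⟩ := exists_floor (N := P.len) (mul_nonneg hpos.le t.2.1)
        (mul_lt_of_lt_one_right hpos h)
      exact ⟨i, hi, P.param_mem_side hi h1 h2.le⟩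
    · obtain rfl : t = 1 := Subtype.ext h
      refine ⟨P.len - 1, by omega, ?_⟩
      rw [curve_one, side, Nat.sub_add_cancel (by omega)]
      exact right_mem_segment _ _ _
  · rintro ⟨i, hi, hx⟩
    obtain ⟨t, t0, t1, rfl⟩ := Plane.mem_segment_iff.1 hx
    have hi' : (i : ℝ) + 1 ≤ P.len := by exact_mod_cast hi
    refine ⟨⟨(i + t) / P.len, by positivity, (div_le_one hpos).2 (by linarith)⟩, ?_⟩
    change P.param (P.len * ((i + t) / P.len)) = _
    rw [mul_div_cancel₀ _ hpos.ne', P.param_eq hi (by linarith) (by linarith)]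
    simp

end Polyline

/-! ### Parallel copies of one polygonal line -/

namespace Polyline

/-- The corners of a polygonal line moved by `s` times the vectors `m i` turned by a right angle. -/
noncomputable def offset (P : Polyline) (m : ℕ → Plane) (s : ℝ) : Polyline where
  len := P.len
  pt i := P.pt i + s • Plane.rot (m i)

/-- The vector `m i` has positive inner products with the sides before and after the corner
`pt i`, and vanishes at the two ends. -/
structure IsBisector (P : Polyline) (m : ℕ → Plane) : Prop where
  first : m 0 = 0
  last : m P.len = 0
  before : ∀ i, i + 1 < P.len → 0 < inner ℝ (m (i + 1)) (P.pt (i + 1) - P.pt i)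
  after : ∀ i, i + 1 < P.len → 0 < inner ℝ (m (i + 1)) (P.pt (i + 2) - P.pt (i + 1))

variable {P : Polyline} {m : ℕ → Plane}

lemma rot_zero : Plane.rot 0 = 0 := by
  ext i; fin_cases i <;> simp [Plane.rot]

lemma IsSimple.exists_isBisector (hP : P.IsSimple) : ∃ m, P.IsBisector m := by
  have key : ∀ i, ∃ v : Plane, i + 1 < P.len → 0 < inner ℝ v (P.pt (i + 1) - P.pt i) ∧
      0 < inner ℝ v (P.pt (i + 2) - P.pt (i + 1)) := by
    intro i
    by_cases hi : i + 1 < P.len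
    · have hsp : Plane.Spread (P.pt i - P.pt (i + 1)) (P.pt (i + 2) - P.pt (i + 1)) := by
        refine Plane.spread_of_segment_inter (hP.ne i (by omega)) (hP.ne (i + 1) hi).symm ?_
        rw [segment_symm]
        exact hP.adjacent i hi
      rw [← neg_sub] at hsp
      obtain ⟨v, h1, h2⟩ := Plane.exists_inner_pos (sub_ne_zero.2 (hP.ne i (by omega)).symm)
        (sub_ne_zero.2 (hP.ne (i + 1) hi).symm) hsp
      exact ⟨v, fun _ => ⟨h1, h2⟩⟩
    · exact ⟨0, fun h => absurd h hi⟩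
  choose v hv using key
  have hN := hP.two_le
  -- The vector `v i` was chosen for the corner `i + 1`, hence the index `i - 1`.
  refine ⟨fun i => if i = 0 ∨ i = P.len then 0 else v (i - 1), by simp, by simp, ?_, ?_⟩
  · intro i hi
    rw [if_neg (by omega)]
    exact (hv i hi).1
  · intro i hi
    rw [if_neg (by omega)]
    exact (hv i hi).2

variable (P m) in
@[fun_prop] lemma continuous_offset_pt (a : ℝ) (i : ℕ) :
    Continuous fun ε : ℝ => (P.offset m (ε * a)).pt i := by
  unfold offset; fun_prop

@[simp] lemma offset_zero_pt (i : ℕ) : (P.offset m 0).pt i = P.pt i := by simp [offset]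

lemma offset_zero_mul_pt (a : ℝ) (i : ℕ) : (P.offset m (0 * a)).pt i = P.pt i := by simp

lemma offset_zero_mul_side (a : ℝ) (i : ℕ) : (P.offset m (0 * a)).side i = P.side i := by
  simp [side]

lemma IsBisector.offset_pt_zero (hm : P.IsBisector m) (s : ℝ) : (P.offset m s).pt 0 = P.pt 0 := by
  simp [offset, hm.first, rot_zero]

lemma IsBisector.offset_pt_len (hm : P.IsBisector m) (s : ℝ) :
    (P.offset m s).pt P.len = P.pt P.len := by
  simp [offset, hm.last, rot_zero]

lemma eventually_forall_lt {l : Filter ℝ} {p : ℕ → ℝ → Prop} (N : ℕ)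
    (h : ∀ i < N, ∀ᶠ ε in l, p i ε) : ∀ᶠ ε in l, ∀ i < N, p i ε :=
  (Filter.eventually_all_finite (Set.finite_Iio N)).2 h

/-- All copies of a corner lie on one line perpendicular to `m i`. This line will separate the sides
before the corner from those after it, in all copies at once. -/
lemma inner_offset_pt (s : ℝ) (i : ℕ) :
    inner ℝ (m i) ((P.offset m s).pt i) = inner ℝ (m i) (P.pt i) := by
  simp [offset, inner_add_right, real_inner_smul_right, Plane.inner_rot_self]

/-- For small `ε` the functional `inner (m (i + 1))` strictly increases along side `i` of the one
copy up to its value at the corner, and strictly increases from this value along side `i + 1` of the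
other. A common point must have exactly this value, which each side attains only at its own
displaced corner. -/
lemma IsBisector.eventually_adjacent (hm : P.IsBisector m) (a b : ℝ) {i : ℕ} (hi : i + 1 < P.len) :
    ∀ᶠ ε in 𝓝 (0 : ℝ), ∀ x ∈ (P.offset m (ε * a)).side i ∩ (P.offset m (ε * b)).side (i + 1),
      x = (P.offset m (ε * a)).pt (i + 1) ∧ x = (P.offset m (ε * b)).pt (i + 1) := by
  have h1 : ∀ᶠ ε in 𝓝 (0 : ℝ), inner ℝ (m (i + 1)) ((P.offset m (ε * a)).pt i) <
      inner ℝ (m (i + 1)) (P.pt (i + 1)) := by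
    have : Continuous fun ε : ℝ => inner ℝ (m (i + 1)) ((P.offset m (ε * a)).pt i) := by fun_prop
    refine this.continuousAt.eventually_lt continuousAt_const ?_
    rw [offset_zero_mul_pt]
    have := hm.before i hi
    rw [inner_sub_right] at this
    linarith
  have h2 : ∀ᶠ ε in 𝓝 (0 : ℝ), inner ℝ (m (i + 1)) (P.pt (i + 1)) <
      inner ℝ (m (i + 1)) ((P.offset m (ε * b)).pt (i + 2)) := by
    have : Continuous fun ε : ℝ => inner ℝ (m (i + 1)) ((P.offset m (ε * b)).pt (i + 2)) := by
      fun_prop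
    refine continuousAt_const.eventually_lt this.continuousAt ?_
    rw [offset_zero_mul_pt]
    have := hm.after i hi
    rw [inner_sub_right] at this
    linarith
  filter_upwards [h1, h2] with ε h1 h2
  rintro x ⟨hx, hx'⟩
  obtain ⟨t, t0, t1, ht⟩ := Plane.mem_segment_iff.1 hx
  obtain ⟨s, s0, s1, hs⟩ := Plane.mem_segment_iff.1 hx'
  have e1 := congrArg (inner ℝ (m (i + 1))) ht
  have e2 := congrArg (inner ℝ (m (i + 1))) hs
  rw [inner_add_right, real_inner_smul_right, inner_sub_right, inner_offset_pt] at e1 e2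
  set A := inner ℝ (m (i + 1)) ((P.offset m (ε * a)).pt i)
  set B := inner ℝ (m (i + 1)) ((P.offset m (ε * b)).pt (i + 2))
  set C := inner ℝ (m (i + 1)) (P.pt (i + 1))
  have h3 : 0 ≤ (1 - t) * (C - A) := mul_nonneg (by linarith) (by linarith)
  have h4 : 0 ≤ s * (B - C) := mul_nonneg s0 (by linarith)
  have h5 : (1 - t) * (C - A) = 0 := by nlinarith
  have h6 : s * (B - C) = 0 := by nlinarith
  have h7 : t = 1 := by
    rcases mul_eq_zero.1 h5 with h | h <;> linarith
  have h8 : s = 0 := by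
    rcases mul_eq_zero.1 h6 with h | h <;> linarith
  exact ⟨by rw [ht, h7]; simp, by rw [hs, h8]; simp⟩

lemma IsBisector.eventually_isSimple (hP : P.IsSimple) (hm : P.IsBisector m) (a : ℝ) :
    ∀ᶠ ε in 𝓝 (0 : ℝ), (P.offset m (ε * a)).IsSimple := by
  have h1 : ∀ᶠ ε in 𝓝 (0 : ℝ), ∀ i < P.len,
      (P.offset m (ε * a)).pt i ≠ (P.offset m (ε * a)).pt (i + 1) := by
    refine eventually_forall_lt _ fun i hi => ?_
    have hc : Continuous fun ε : ℝ =>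
      (P.offset m (ε * a)).pt i - (P.offset m (ε * a)).pt (i + 1) := by fun_prop
    have hne := hc.continuousAt.eventually_ne (x := 0) (y := 0) (by
      simpa only [offset_zero_mul_pt] using sub_ne_zero.2 (hP.ne i hi))
    exact hne.mono fun ε hε => sub_ne_zero.1 hε
  have h2 : ∀ᶠ ε in 𝓝 (0 : ℝ), ∀ i < P.len, ∀ j < P.len, i + 1 < j →
      Disjoint ((P.offset m (ε * a)).side i) ((P.offset m (ε * a)).side j) := by
    refine eventually_forall_lt _ fun i hi => eventually_forall_lt _ fun j hj => ?_
    by_cases hij : i + 1 < j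
    · simp only [hij, forall_true_left]
      refine Plane.eventually_disjoint_segment (by fun_prop) (by fun_prop) (by fun_prop)
        (by fun_prop) ?_
      simp only [offset_zero_mul_pt]
      exact hP.disjoint i j hij hj
    · simp [hij]
  have h3 : ∀ᶠ ε in 𝓝 (0 : ℝ), ∀ i < P.len - 1,
      (P.offset m (ε * a)).side i ∩ (P.offset m (ε * a)).side (i + 1) ⊆
        {(P.offset m (ε * a)).pt (i + 1)} := by
    refine eventually_forall_lt _ fun i hi => ?_
    filter_upwards [hm.eventually_adjacent a a (i := i) (by omega)] with ε hε x hx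
    exact (hε x hx).1
  filter_upwards [h1, h2, h3] with ε h1 h2 h3
  exact ⟨hP.two_le, h1, fun i j hij hj => h2 i (by change j < P.len at hj; omega) j hj hij,
    fun i hi => h3 i (by change i + 1 < P.len at hi; omega)⟩

/-- A common point would be the displaced corner of both copies, but these differ by a nonzero
multiple of `rot (m (i + 1))`. -/
lemma IsBisector.eventually_disjoint_adjacent (hm : P.IsBisector m) {a b : ℝ} (hab : a ≠ b)
    {i : ℕ} (hi : i + 1 < P.len) :
    ∀ᶠ ε in 𝓝[>] (0 : ℝ),
      Disjoint ((P.offset m (ε * a)).side i) ((P.offset m (ε * b)).side (i + 1)) := by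
  filter_upwards [nhdsWithin_le_nhds (hm.eventually_adjacent a b hi), self_mem_nhdsWithin]
    with ε hε hpos
  rw [Set.disjoint_iff_inter_eq_empty, Set.eq_empty_iff_forall_notMem]
  intro x hx
  obtain ⟨h1, h2⟩ := hε x hx
  have h3 : (ε * (a - b)) • Plane.rot (m (i + 1)) = 0 := by
    have : ((P.offset m (ε * a)).pt (i + 1)) - ((P.offset m (ε * b)).pt (i + 1)) = 0 := by
      rw [← h1, ← h2, sub_self]
    rw [← this]; simp only [offset]; module
  rcases smul_eq_zero.1 h3 with h | h
  · rcases mul_eq_zero.1 h with h | h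
    · exact (ne_of_gt hpos) h
    · exact hab (sub_eq_zero.1 h)
  · have h4 := hm.before i hi
    rw [← Plane.cross_rot, h] at h4
    simp [Plane.cross] at h4

/-- An inner corner of copy `b` lies strictly to the left of the direction of the corresponding side
of copy `a`, because `cross d (rot (m i)) = inner (m i) d > 0`. Hence the two sides can meet only in
a fixed end of the whole line. As there are at least two sides, no side has both its ends fixed. -/
lemma IsBisector.eventually_same_side (hP : P.IsSimple) (hm : P.IsBisector m) {a b : ℝ}
    (hab : a < b) {i : ℕ} (hi : i < P.len) :
    ∀ᶠ ε in 𝓝[>] (0 : ℝ), ∀ x ∈ (P.offset m (ε * a)).side i ∩ (P.offset m (ε * b)).side i,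
      x = P.pt 0 ∨ x = P.pt P.len := by
  have hN := hP.two_le
  have hd : Continuous fun ε : ℝ =>
    (P.offset m (ε * a)).pt (i + 1) - (P.offset m (ε * a)).pt i := by fun_prop
  have h1 : ∀ᶠ ε in 𝓝 (0 : ℝ), i ≠ 0 → 0 < inner ℝ (m i)
      ((P.offset m (ε * a)).pt (i + 1) - (P.offset m (ε * a)).pt i) := by
    by_cases h0 : i = 0
    · simp [h0]
    · simp only [ne_eq, h0, not_false_eq_true, forall_true_left]
      refine continuousAt_const.eventually_lt (continuous_const.inner hd).continuousAt ?_
      simp only [offset_zero_mul_pt]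
      obtain ⟨j, rfl⟩ := Nat.exists_eq_succ_of_ne_zero h0
      exact hm.after j hi
  have h2 : ∀ᶠ ε in 𝓝 (0 : ℝ), i + 1 ≠ P.len → 0 < inner ℝ (m (i + 1))
      ((P.offset m (ε * a)).pt (i + 1) - (P.offset m (ε * a)).pt i) := by
    by_cases h0 : i + 1 = P.len
    · simp [h0]
    · simp only [ne_eq, h0, not_false_eq_true, forall_true_left]
      refine continuousAt_const.eventually_lt (continuous_const.inner hd).continuousAt ?_
      simp only [offset_zero_mul_pt]
      exact hm.before i (by omega)
  filter_upwards [nhdsWithin_le_nhds h1, nhdsWithin_le_nhds h2, self_mem_nhdsWithin]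
    with ε h1 h2 (hpos : 0 < ε)
  rintro x ⟨hx, hx'⟩
  obtain ⟨s, s0, s1, hs⟩ := Plane.mem_segment_iff.1 hx
  obtain ⟨t, t0, t1, ht⟩ := Plane.mem_segment_iff.1 hx'
  set d := (P.offset m (ε * a)).pt (i + 1) - (P.offset m (ε * a)).pt i with hd'
  -- This is the signed height of the common point over the line of copy `a`, interpolated between
  -- the heights of the two corners of copy `b`.
  have key : (1 - t) * (ε * (b - a) * inner ℝ (m i) d) +
      t * (ε * (b - a) * inner ℝ (m (i + 1)) d) = 0 := by
    have e1 : s • d = (1 - t) • ((ε * (b - a)) • Plane.rot (m i)) +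
        t • ((ε * (b - a)) • Plane.rot (m (i + 1))) + t • d := by
      have h3 : (P.offset m (ε * b)).pt i =
          (P.offset m (ε * a)).pt i + (ε * (b - a)) • Plane.rot (m i) := by
        simp only [offset]; module
      have h4 : (P.offset m (ε * b)).pt (i + 1) =
          (P.offset m (ε * a)).pt (i + 1) + (ε * (b - a)) • Plane.rot (m (i + 1)) := by
        simp only [offset]; module
      have h5 : s • d = x - (P.offset m (ε * a)).pt i := by rw [hs]; module
      rw [h5, ht, h3, h4, hd']; module
    have e2 := congrArg (Plane.cross d) e1
    simp only [Plane.cross_add_right, Plane.cross_smul_right, Plane.cross_self,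
      Plane.cross_rot] at e2
    linarith
  have hc : 0 < ε * (b - a) := mul_pos hpos (by linarith)
  by_cases hi0 : i = 0
  · subst hi0
    have hB := mul_pos hc (h2 (by omega))
    rw [hm.first, inner_zero_left, mul_zero, mul_zero, zero_add] at key
    left
    rw [ht, (mul_eq_zero.1 key).resolve_right hB.ne', hm.offset_pt_zero]; simp
  · have hA := mul_pos hc (h1 hi0)
    by_cases hiN : i + 1 = P.len
    · rw [hiN, hm.last, inner_zero_left, mul_zero, mul_zero, add_zero] at key
      have : t = 1 := by linarith [(mul_eq_zero.1 key).resolve_right hA.ne']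
      right
      rw [ht, this, one_smul, add_sub_cancel, hiN, hm.offset_pt_len]
    · have hB := mul_pos hc (h2 hiN)
      exfalso
      rcases t0.eq_or_lt with h | h
      · rw [← h, zero_mul, sub_zero, one_mul, add_zero] at key
        exact hA.ne' key
      · have := mul_pos h hB
        have := mul_nonneg (sub_nonneg.2 t1) hA.le
        linarith

lemma IsBisector.eventually_inter_subset (hP : P.IsSimple) (hm : P.IsBisector m) {a b : ℝ}
    (hab : a ≠ b) :
    ∀ᶠ ε in 𝓝[>] (0 : ℝ), ∀ x ∈ (P.offset m (ε * a)).carrier ∩ (P.offset m (ε * b)).carrier,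
      x = P.pt 0 ∨ x = P.pt P.len := by
  have key : ∀ᶠ ε in 𝓝[>] (0 : ℝ), ∀ i < P.len, ∀ j < P.len,
      ∀ x ∈ (P.offset m (ε * a)).side i ∩ (P.offset m (ε * b)).side j,
        x = P.pt 0 ∨ x = P.pt P.len := by
    refine eventually_forall_lt _ fun i hi => eventually_forall_lt _ fun j hj => ?_
    have hfar : Disjoint (P.side i) (P.side j) → ∀ᶠ ε in 𝓝[>] (0 : ℝ),
        ∀ x ∈ (P.offset m (ε * a)).side i ∩ (P.offset m (ε * b)).side j,
          x = P.pt 0 ∨ x = P.pt P.len := by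
      intro h
      have := Plane.eventually_disjoint_segment (continuous_offset_pt P m a i)
        (continuous_offset_pt P m a (i + 1))
        (continuous_offset_pt P m b j) (continuous_offset_pt P m b (j + 1))
        (by simpa only [offset_zero_mul_pt, side] using h)
      filter_upwards [nhdsWithin_le_nhds this] with ε hε x hx
      exact absurd hx.2 (Set.disjoint_left.1 hε hx.1)
    rcases Nat.lt_trichotomy i j with h | rfl | h
    · rcases Nat.lt_or_ge (i + 1) j with h' | h'
      · exact hfar (hP.disjoint i j h' hj)
      · obtain rfl : j = i + 1 := by omega
        filter_upwards [hm.eventually_disjoint_adjacent hab hj] with ε hε x hx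
        exact absurd hx.2 (Set.disjoint_left.1 hε hx.1)
    · rcases hab.lt_or_gt with h | h
      · exact hm.eventually_same_side hP h hi
      · filter_upwards [hm.eventually_same_side hP h hi] with ε hε x hx
        exact hε x hx.symm
    · rcases Nat.lt_or_ge (j + 1) i with h' | h'
      · exact hfar (hP.disjoint j i h' hi).symm
      · obtain rfl : i = j + 1 := by omega
        filter_upwards [hm.eventually_disjoint_adjacent hab.symm hi] with ε hε x hx
        exact absurd hx.1 (Set.disjoint_left.1 hε hx.2)
  filter_upwards [key] with ε hε
  rintro x ⟨⟨i, hi, hx⟩, ⟨j, hj, hx'⟩⟩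
  exact hε i hi j hj x ⟨hx, hx'⟩

/-- The ends of the line do not move, so a perturbed side at such an end is still a segment from the
same point. -/
lemma IsBisector.exists_side_eq (hP : P.IsSimple) (hm : P.IsBisector m) (a : ℝ) {i : ℕ}
    (hi : i < P.len) {x : Plane} (hx : x ∈ P.side i) (hx' : x = P.pt 0 ∨ x = P.pt P.len) :
    ∃ q : ℝ → Plane, Continuous q ∧ q 0 ≠ x ∧
      ∀ ε, (P.offset m (ε * a)).side i = segment ℝ x (q ε) := by
  rcases hx' with rfl | rfl
  · obtain rfl := hP.eq_zero_of_mem_side hi hx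
    refine ⟨fun ε => (P.offset m (ε * a)).pt 1, by fun_prop, ?_, fun ε => ?_⟩
    · simpa using (hP.ne 0 hi).symm
    · rw [side, hm.offset_pt_zero]
  · have h := hP.eq_of_last_mem_side hi hx
    refine ⟨fun ε => (P.offset m (ε * a)).pt i, by fun_prop, ?_, fun ε => ?_⟩
    · simpa [← h] using hP.ne i hi
    · rw [side, h, hm.offset_pt_len, segment_symm]

end Polyline

/-! ### Copies of a whole system of polygonal lines -/

/-- A finite system of simple polygonal lines with ends in `V`, which contain no other points
of `V`, and any two of which intersect, apart from `V`, in transversal crossings of their sides. -/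
structure PolygonalSystem {β : Type*} (E : Set β) (V : Set Plane) (P : β → Polyline) : Prop where
  simple : ∀ e ∈ E, (P e).IsSimple
  first_mem : ∀ e ∈ E, (P e).pt 0 ∈ V
  last_mem : ∀ e ∈ E, (P e).pt (P e).len ∈ V
  eq_of_mem : ∀ e ∈ E, ∀ x ∈ V, x ∈ (P e).carrier → x = (P e).pt 0 ∨ x = (P e).pt (P e).len
  subsingleton : ∀ e ∈ E, ∀ f ∈ E, e ≠ f → ∀ i < (P e).len, ∀ j < (P f).len,
    ((P e).side i ∩ (P f).side j).Subsingleton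
  transversal : ∀ e ∈ E, ∀ f ∈ E, e ≠ f → ∀ i < (P e).len, ∀ j < (P f).len,
    ∀ x ∈ (P e).side i ∩ (P f).side j, x ∉ V →
      Plane.cross ((P e).pt (i + 1) - (P e).pt i) ((P f).pt (j + 1) - (P f).pt j) ≠ 0
  no_three : ∀ e ∈ E, ∀ f ∈ E, ∀ g ∈ E, e ≠ f → e ≠ g → f ≠ g →
    (P e).carrier ∩ (P f).carrier ∩ (P g).carrier ⊆ V

/-- The pairs of sides of two polygonal lines that intersect in a point outside `V`. -/
def crossingSides (V : Set Plane) (P Q : Polyline) : Set (ℕ × ℕ) :=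
  {x | x.1 < P.len ∧ x.2 < Q.len ∧ ∃ y ∈ P.side x.1 ∩ Q.side x.2, y ∉ V}

namespace PolygonalSystem

open Polyline

variable {β : Type*} {E : Set β} {V : Set Plane} {P : β → Polyline} {m : β → ℕ → Plane}

/-- Two sides that meet in a vertex have it as their only common point, so they leave it along
different rays. This is stable under perturbation, and the vertex stays fixed. -/
lemma eventually_inter_subset_of_mem (h : PolygonalSystem E V P)
    (hm : ∀ e ∈ E, (P e).IsBisector (m e)) {e f : β} (he : e ∈ E) (hf : f ∈ E) (hef : e ≠ f)
    {i j : ℕ} (hi : i < (P e).len) (hj : j < (P f).len) (a b : ℝ) {x : Plane}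
    (hx : x ∈ (P e).side i ∩ (P f).side j) (hxV : x ∈ V) :
    ∀ᶠ ε in 𝓝 (0 : ℝ),
      ((P e).offset (m e) (ε * a)).side i ∩ ((P f).offset (m f) (ε * b)).side j ⊆ V := by
  obtain ⟨q, hq, hq0, hqs⟩ := (hm e he).exists_side_eq (h.simple e he) a hi hx.1
    (h.eq_of_mem e he x hxV ⟨i, hi, hx.1⟩)
  obtain ⟨q', hq', hq0', hqs'⟩ := (hm f hf).exists_side_eq (h.simple f hf) b hj hx.2
    (h.eq_of_mem f hf x hxV ⟨j, hj, hx.2⟩)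
  have hsp : Plane.Spread (q 0 - x) (q' 0 - x) := by
    refine Plane.spread_of_segment_inter hq0 hq0' ?_
    rw [← hqs, ← hqs', offset_zero_mul_side, offset_zero_mul_side]
    exact fun y hy => h.subsingleton e he f hf hef i hi j hj hy hx
  filter_upwards [Plane.Spread.eventually (hq.sub continuous_const) (hq'.sub continuous_const) hsp]
    with ε hε y hy
  rw [hqs, hqs'] at hy
  rw [Set.mem_singleton_iff.1 (hε.segment_inter hy)]
  exact hxV

/-- Disjoint sides stay disjoint, sides that meet at a vertex meet nowhere else, and sides that
cross transversally stay nonparallel, hence meet at most once. So perturbation creates no new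
crossing pairs of sides. -/
lemma eventually_crossingSides (h : PolygonalSystem E V P)
    (hm : ∀ e ∈ E, (P e).IsBisector (m e)) {e f : β} (he : e ∈ E) (hf : f ∈ E) (hef : e ≠ f)
    (a b : ℝ) :
    ∀ᶠ ε in 𝓝 (0 : ℝ), ∀ i < (P e).len, ∀ j < (P f).len,
      ∀ x ∈ ((P e).offset (m e) (ε * a)).side i ∩ ((P f).offset (m f) (ε * b)).side j,
        x ∈ V ∨ ((i, j) ∈ crossingSides V (P e) (P f) ∧
          (((P e).offset (m e) (ε * a)).side i ∩
            ((P f).offset (m f) (ε * b)).side j).Subsingleton) := by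
  refine eventually_forall_lt _ fun i hi => eventually_forall_lt _ fun j hj => ?_
  by_cases hdis : Disjoint ((P e).side i) ((P f).side j)
  · have := Plane.eventually_disjoint_segment (continuous_offset_pt (P e) (m e) a i)
      (continuous_offset_pt (P e) (m e) a (i + 1))
      (continuous_offset_pt (P f) (m f) b j) (continuous_offset_pt (P f) (m f) b (j + 1))
      (by simpa only [offset_zero_mul_pt, side] using hdis)
    filter_upwards [this] with ε hε x hx
    exact absurd hx.2 (Set.disjoint_left.1 hε hx.1)
  · obtain ⟨x, hx⟩ := Set.not_disjoint_iff_nonempty_inter.1 hdis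
    by_cases hxV : x ∈ V
    · filter_upwards [h.eventually_inter_subset_of_mem hm he hf hef hi hj a b hx hxV] with ε hε y hy
      exact Or.inl (hε hy)
    · have hc : Continuous fun ε : ℝ => Plane.cross
          (((P e).offset (m e) (ε * a)).pt (i + 1) - ((P e).offset (m e) (ε * a)).pt i)
          (((P f).offset (m f) (ε * b)).pt (j + 1) - ((P f).offset (m f) (ε * b)).pt j) := by
        fun_prop
      have hne := hc.continuousAt.eventually_ne (x := 0) (y := 0) (by
        simpa only [offset_zero_mul_pt] using h.transversal e he f hf hef i hi j hj x hx hxV)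
      filter_upwards [hne] with ε hε y hy
      exact Or.inr ⟨⟨hi, hj, x, hx, hxV⟩, Plane.segment_inter_subsingleton hε⟩

lemma eventually_no_three (h : PolygonalSystem E V P)
    (hm : ∀ e ∈ E, (P e).IsBisector (m e)) {e f g : β} (he : e ∈ E) (hf : f ∈ E) (hg : g ∈ E)
    (hef : e ≠ f) (heg : e ≠ g) (hfg : f ≠ g) (a b c : ℝ) :
    ∀ᶠ ε in 𝓝 (0 : ℝ), ((P e).offset (m e) (ε * a)).carrier ∩
      ((P f).offset (m f) (ε * b)).carrier ∩ ((P g).offset (m g) (ε * c)).carrier ⊆ V := by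
  have key : ∀ᶠ ε in 𝓝 (0 : ℝ), ∀ i < (P e).len, ∀ j < (P f).len, ∀ l < (P g).len,
      ((P e).offset (m e) (ε * a)).side i ∩ ((P f).offset (m f) (ε * b)).side j ∩
        ((P g).offset (m g) (ε * c)).side l ⊆ V := by
    refine eventually_forall_lt _ fun i hi => eventually_forall_lt _ fun j hj =>
      eventually_forall_lt _ fun l hl => ?_
    rcases ((P e).side i ∩ (P f).side j ∩ (P g).side l).eq_empty_or_nonempty with hemp | ⟨x, hx⟩
    · have := Plane.eventually_segment_inter_eq_empty₃
        (continuous_offset_pt (P e) (m e) a i) (continuous_offset_pt (P e) (m e) a (i + 1))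
        (continuous_offset_pt (P f) (m f) b j) (continuous_offset_pt (P f) (m f) b (j + 1))
        (continuous_offset_pt (P g) (m g) c l) (continuous_offset_pt (P g) (m g) c (l + 1))
        (by simpa only [offset_zero_mul_pt, side] using hemp)
      filter_upwards [this] with ε hε
      exact hε.subset.trans (Set.empty_subset _)
    · have hxV : x ∈ V := h.no_three e he f hf g hg hef heg hfg
        ⟨⟨⟨i, hi, hx.1.1⟩, ⟨j, hj, hx.1.2⟩⟩, ⟨l, hl, hx.2⟩⟩
      filter_upwards [h.eventually_inter_subset_of_mem hm he hf hef hi hj a b hx.1 hxV] with ε hε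
      exact Set.inter_subset_left.trans hε
  filter_upwards [key] with ε hε
  rintro x ⟨⟨⟨i, hi, hx⟩, ⟨j, hj, hx'⟩⟩, ⟨l, hl, hx''⟩⟩
  exact hε i hi j hj l hl ⟨⟨hx, hx'⟩, hx''⟩

lemma eventually_eq_of_mem (h : PolygonalSystem E V P) (hV : V.Finite) {e : β} (he : e ∈ E)
    (a : ℝ) :
    ∀ᶠ ε in 𝓝 (0 : ℝ), ∀ x ∈ V, x ∈ ((P e).offset (m e) (ε * a)).carrier →
      x = (P e).pt 0 ∨ x = (P e).pt (P e).len := by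
  refine (Filter.eventually_all_finite hV).2 fun x hx => ?_
  by_cases hxc : x ∈ (P e).carrier
  · exact Eventually.of_forall fun ε _ => h.eq_of_mem e he x hx hxc
  · have : ∀ᶠ ε in 𝓝 (0 : ℝ), ∀ i < (P e).len, x ∉ ((P e).offset (m e) (ε * a)).side i := by
      refine eventually_forall_lt _ fun i hi => ?_
      refine Plane.eventually_notMem_segment (by fun_prop) (by fun_prop) x ?_
      simp only [offset_zero_mul_pt]
      exact fun hxs => hxc ⟨i, hi, hxs⟩
    filter_upwards [this] with ε hε
    rintro ⟨i, hi, hxs⟩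
    exact absurd hxs (hε i hi)

/-- Several copies of the lines of a polygonal system, drawn along them. -/
theorem exists_copies (h : PolygonalSystem E V P) (hV : V.Finite) {β' : Type*} {E' : Set β'}
    (hE' : E'.Finite) (π : β' → β) (c : β' → ℝ) (hπ : ∀ e ∈ E', π e ∈ E)
    (hc : ∀ e ∈ E', ∀ f ∈ E', e ≠ f → π e = π f → c e ≠ c f) :
    ∃ Q : β' → Polyline,
      (∀ e ∈ E', (Q e).IsSimple) ∧
      (∀ e ∈ E', (Q e).len = (P (π e)).len ∧ (Q e).pt 0 = (P (π e)).pt 0 ∧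
        (Q e).pt (Q e).len = (P (π e)).pt (P (π e)).len) ∧
      (∀ e ∈ E', ∀ x ∈ V, x ∈ (Q e).carrier →
        x = (P (π e)).pt 0 ∨ x = (P (π e)).pt (P (π e)).len) ∧
      (∀ e ∈ E', ∀ f ∈ E', e ≠ f → π e = π f → (Q e).carrier ∩ (Q f).carrier ⊆ V) ∧
      (∀ e ∈ E', ∀ f ∈ E', π e ≠ π f → ∀ i < (Q e).len, ∀ j < (Q f).len,
        ∀ x ∈ (Q e).side i ∩ (Q f).side j,
          x ∈ V ∨ ((i, j) ∈ crossingSides V (P (π e)) (P (π f)) ∧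
            ((Q e).side i ∩ (Q f).side j).Subsingleton)) ∧
      (∀ e ∈ E', ∀ f ∈ E', ∀ g ∈ E', π e ≠ π f → π e ≠ π g → π f ≠ π g →
        (Q e).carrier ∩ (Q f).carrier ∩ (Q g).carrier ⊆ V) := by
  have hex : ∀ e, ∃ m, e ∈ E → (P e).IsBisector m := fun e => by
    by_cases he : e ∈ E
    · obtain ⟨m, hm⟩ := (h.simple e he).exists_isBisector
      exact ⟨m, fun _ => hm⟩
    · exact ⟨0, fun h' => absurd h' he⟩
  choose m hm using hex
  have all := fun (p : β' → ℝ → Prop) => Filter.eventually_all_finite (l := 𝓝[>] (0 : ℝ)) hE'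
    (p := p)
  have h1 : ∀ᶠ ε in 𝓝[>] (0 : ℝ), ∀ e ∈ E',
      ((P (π e)).offset (m (π e)) (ε * c e)).IsSimple :=
    (all _).2 fun e he => nhdsWithin_le_nhds
      ((hm _ (hπ e he)).eventually_isSimple (h.simple _ (hπ e he)) _)
  have h2 : ∀ᶠ ε in 𝓝[>] (0 : ℝ), ∀ e ∈ E', ∀ x ∈ V,
      x ∈ ((P (π e)).offset (m (π e)) (ε * c e)).carrier →
        x = (P (π e)).pt 0 ∨ x = (P (π e)).pt (P (π e)).len :=
    (all _).2 fun e he => nhdsWithin_le_nhds (h.eventually_eq_of_mem hV (hπ e he) _)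
  have h3 : ∀ᶠ ε in 𝓝[>] (0 : ℝ), ∀ e ∈ E', ∀ f ∈ E', e ≠ f → π e = π f →
      ((P (π e)).offset (m (π e)) (ε * c e)).carrier ∩
        ((P (π f)).offset (m (π f)) (ε * c f)).carrier ⊆ V := by
    refine (all _).2 fun e he => (all _).2 fun f hf => ?_
    by_cases hef : e ≠ f ∧ π e = π f
    · filter_upwards [(hm _ (hπ e he)).eventually_inter_subset (h.simple _ (hπ e he))
        (hc e he f hf hef.1 hef.2)] with ε hε _ _ x hx
      rw [← hef.2] at hx
      rcases hε x hx with rfl | rfl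
      · exact h.first_mem _ (hπ e he)
      · exact h.last_mem _ (hπ e he)
    · exact Eventually.of_forall fun ε h1 h2 => absurd ⟨h1, h2⟩ hef
  have h4 : ∀ᶠ ε in 𝓝[>] (0 : ℝ), ∀ e ∈ E', ∀ f ∈ E', π e ≠ π f →
      ∀ i < (P (π e)).len, ∀ j < (P (π f)).len,
      ∀ x ∈ ((P (π e)).offset (m (π e)) (ε * c e)).side i ∩
          ((P (π f)).offset (m (π f)) (ε * c f)).side j,
        x ∈ V ∨ ((i, j) ∈ crossingSides V (P (π e)) (P (π f)) ∧
          (((P (π e)).offset (m (π e)) (ε * c e)).side i ∩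
            ((P (π f)).offset (m (π f)) (ε * c f)).side j).Subsingleton) := by
    refine (all _).2 fun e he => (all _).2 fun f hf => ?_
    by_cases hef : π e ≠ π f
    · filter_upwards [nhdsWithin_le_nhds (h.eventually_crossingSides hm (hπ e he) (hπ f hf) hef
        (c e) (c f))] with ε hε _
      exact hε
    · exact Eventually.of_forall fun ε h1 => absurd h1 hef
  have h5 : ∀ᶠ ε in 𝓝[>] (0 : ℝ), ∀ e ∈ E', ∀ f ∈ E', ∀ g ∈ E',
      π e ≠ π f → π e ≠ π g → π f ≠ π g →
      ((P (π e)).offset (m (π e)) (ε * c e)).carrier ∩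
        ((P (π f)).offset (m (π f)) (ε * c f)).carrier ∩
        ((P (π g)).offset (m (π g)) (ε * c g)).carrier ⊆ V := by
    refine (all _).2 fun e he => (all _).2 fun f hf => (all _).2 fun g hg => ?_
    by_cases hd : π e ≠ π f ∧ π e ≠ π g ∧ π f ≠ π g
    · filter_upwards [nhdsWithin_le_nhds (h.eventually_no_three hm (hπ e he) (hπ f hf) (hπ g hg)
        hd.1 hd.2.1 hd.2.2 (c e) (c f) (c g))] with ε hε _ _ _
      exact hε
    · exact Eventually.of_forall fun ε h1 h2 h3 => absurd ⟨h1, h2, h3⟩ hd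
  -- These are finitely many conditions, each true for all small `ε > 0`. The value `ε = 0` must be
  -- avoided, since all copies of a line coincide there.
  obtain ⟨ε, h1, h2, h3, h4, h5⟩ := (h1.and (h2.and (h3.and (h4.and h5)))).exists
  exact ⟨fun e => (P (π e)).offset (m (π e)) (ε * c e), h1,
    fun e he => ⟨rfl, (hm _ (hπ e he)).offset_pt_zero _, (hm _ (hπ e he)).offset_pt_len _⟩,
    h2, h3, h4, h5⟩

end PolygonalSystem

/-! ### Straightening curves in disks -/

/-- Between its first and its last visit to a closed disk, a curve can be replaced by a chord. -/
lemma exists_replace_by_chord (γ : C(unitInterval, Plane)) (s : Plane) (r : ℝ)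
    (hne : ∃ t, γ t ∈ Metric.closedBall s r) :
    ∃ (γ' : C(unitInterval, Plane)) (a b : unitInterval), γ' 0 = γ 0 ∧ γ' 1 = γ 1 ∧
      γ a ∈ Metric.closedBall s r ∧ γ b ∈ Metric.closedBall s r ∧
      (γ 0 ∈ Metric.closedBall s r → a = 0) ∧ (γ 1 ∈ Metric.closedBall s r → b = 1) ∧
      (a = 0 ∨ γ a ∈ Metric.sphere s r) ∧ (b = 1 ∨ γ b ∈ Metric.sphere s r) ∧
      Set.range γ' ⊆ (Set.range γ \ Metric.closedBall s r) ∪ segment ℝ (γ a) (γ b) := by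
  set T : Set unitInterval := γ ⁻¹' Metric.closedBall s r with hT
  have hTc : IsCompact T := (Metric.isClosed_closedBall.preimage γ.continuous).isCompact
  obtain ⟨a, ha⟩ := hTc.exists_isLeast hne
  obtain ⟨b, hb⟩ := hTc.exists_isGreatest hne
  have hab : a ≤ b := ha.2 hb.1
  have hab' : (a : ℝ) ≤ b := hab
  have hball : ∀ t ∈ T, γ t ∉ Metric.sphere s r → T ∈ 𝓝 t := by
    intro t ht hns
    have : γ t ∈ Metric.ball s r :=
      lt_of_le_of_ne (Metric.mem_closedBall.1 ht) hns
    exact Filter.mem_of_superset ((Metric.isOpen_ball.preimage γ.continuous).mem_nhds this)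
      (Set.preimage_mono Metric.ball_subset_closedBall)
  -- A first visit at a time `a > 0` lies on the circle; otherwise slightly earlier times would be
  -- visits too.
  have ha' : a = 0 ∨ γ a ∈ Metric.sphere s r := by
    by_contra! h
    obtain ⟨l, hl, hsub⟩ := exists_Ioc_subset_of_mem_nhds (hball a ha.1 h.2)
      ⟨0, lt_of_le_of_ne bot_le h.1.symm⟩
    obtain ⟨t, hlt, hta⟩ := exists_between hl
    exact absurd (ha.2 (hsub ⟨hlt, hta.le⟩)) (not_le.2 hta)
  have hb' : b = 1 ∨ γ b ∈ Metric.sphere s r := by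
    by_contra! h
    obtain ⟨l, hl, hsub⟩ := exists_Ico_subset_of_mem_nhds (hball b hb.1 h.2)
      ⟨1, lt_of_le_of_ne le_top h.1⟩
    obtain ⟨t, hlt, hta⟩ := exists_between hl
    exact absurd (hb.2 (hsub ⟨hlt.le, hta⟩)) (not_le.2 hlt)
  set κ : unitInterval → ℝ := fun t => max 0 (min (((t : ℝ) - a) / (b - a)) 1) with hκ
  have hκc : Continuous κ := by fun_prop
  have hκ0 : ∀ t, t ≤ a → κ t = 0 := fun t ht => by
    have ht' : (t : ℝ) ≤ a := ht
    exact max_eq_left (min_le_of_left_le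
      (div_nonpos_of_nonpos_of_nonneg (by linarith) (by linarith)))
  have hκ1 : ∀ t, b ≤ t → κ t • (γ b - γ a) = γ b - γ a := fun t ht => by
    rcases hab.eq_or_lt with h | h
    · simp [h]
    · have ht' : (b : ℝ) ≤ t := ht
      have h' : (a : ℝ) < b := h
      have : κ t = 1 := by
        rw [hκ]
        simp only
        rw [min_eq_right ((one_le_div (by linarith)).2 (by linarith)), max_eq_right zero_le_one]
      rw [this, one_smul]
  -- A single formula in place of gluing: before `a`, between `a` and `b`, and after `b`, only one
  -- of the three terms varies. If `a = b`, the chord is a point and the value of `κ` does not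
  -- matter.
  let γ' : C(unitInterval, Plane) :=
    ⟨fun t => γ (min t a) - γ a + (γ (max t b) - γ b) + (γ a + κ t • (γ b - γ a)), by fun_prop⟩
  have hlt : ∀ t, t < a → γ' t = γ t := fun t ht => by
    change γ (min t a) - γ a + (γ (max t b) - γ b) + (γ a + κ t • (γ b - γ a)) = γ t
    rw [min_eq_left ht.le, max_eq_right (ht.le.trans hab), hκ0 t ht.le]
    module
  have hgt : ∀ t, b < t → γ' t = γ t := fun t ht => by
    change γ (min t a) - γ a + (γ (max t b) - γ b) + (γ a + κ t • (γ b - γ a)) = γ t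
    rw [min_eq_right (hab.trans ht.le), max_eq_left ht.le, hκ1 t ht.le]
    module
  have hmid : ∀ t, a ≤ t → t ≤ b → γ' t = γ a + κ t • (γ b - γ a) := fun t h1 h2 => by
    change γ (min t a) - γ a + (γ (max t b) - γ b) + (γ a + κ t • (γ b - γ a)) = _
    rw [min_eq_right h1, max_eq_right h2]
    module
  refine ⟨γ', a, b, ?_, ?_, ha.1, hb.1, fun h => le_antisymm (ha.2 h) bot_le,
    fun h => le_antisymm le_top (hb.2 h), ha', hb', ?_⟩
  · rcases (unitInterval.nonneg' : 0 ≤ a).eq_or_lt with h | h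
    · rw [hmid 0 h.ge (h.le.trans hab), hκ0 0 h.le, ← h]; simp
    · exact hlt 0 h
  · rcases (unitInterval.le_one' : b ≤ 1).eq_or_lt with h | h
    · rw [hmid 1 (hab.trans h.le) h.ge, hκ1 1 h.le, h]; simp
    · exact hgt 1 h
  · rintro _ ⟨t, rfl⟩
    rcases lt_or_ge t a with h | h
    · left
      rw [hlt t h]
      exact ⟨⟨t, rfl⟩, fun h' => absurd (ha.2 h') (not_le.2 h)⟩
    rcases lt_or_ge b t with h' | h'
    · left
      rw [hgt t h']
      exact ⟨⟨t, rfl⟩, fun h'' => absurd (hb.2 h'') (not_le.2 h')⟩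
    · right
      rw [hmid t h h']
      exact Plane.mem_segment_iff.2 ⟨κ t, le_max_left _ _, max_le zero_le_one (min_le_right _ _), rfl⟩

/-- The part of the curve `Γ` in the closed disk with centre `s` and radius `r` lies on a chord (or
on a radius, if `s` is an end of `γ`), whose ends on the circle belong to `γ`. -/
def StraightAt (γ Γ : C(unitInterval, Plane)) (r : ℝ) (s : Plane) : Prop :=
  Disjoint (Set.range Γ) (Metric.closedBall s r) ∨
    ∃ x y, Set.range Γ ∩ Metric.closedBall s r ⊆ segment ℝ x y ∧
      y ∈ Set.range γ ∧ y ∈ Metric.sphere s r ∧ ((s = γ 0 ∨ s = γ 1) → x = s) ∧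
      (s ≠ γ 0 → s ≠ γ 1 → x ∈ Set.range γ ∧ x ∈ Metric.sphere s r)

/-- A curve can be made straight in a finite number of disjoint disks. -/
lemma exists_straight (γ : C(unitInterval, Plane)) (S : Finset Plane) (r : ℝ) (hr : 0 < r)
    (hdis : ∀ s ∈ S, ∀ s' ∈ S, s ≠ s' →
      Disjoint (Metric.closedBall s r) (Metric.closedBall s' r))
    (h0 : γ 0 ∈ S) (h1 : γ 1 ∈ S) (h01 : γ 0 ≠ γ 1) :
    ∃ Γ : C(unitInterval, Plane), Γ 0 = γ 0 ∧ Γ 1 = γ 1 ∧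
      (∀ x ∈ Set.range Γ, x ∈ Set.range γ ∨ ∃ s ∈ S, x ∈ Metric.closedBall s r) ∧
      ∀ s ∈ S, StraightAt γ Γ r s := by
  have hself : ∀ s : Plane, s ∈ Metric.closedBall s r := fun s =>
    Metric.mem_closedBall_self hr.le
  have huniq : ∀ s ∈ S, ∀ s' ∈ S, ∀ x, x ∈ Metric.closedBall s r → x ∈ Metric.closedBall s' r →
      s = s' := fun s hs s' hs' x hx hx' => by
    by_contra hne
    exact Set.disjoint_left.1 (hdis s hs s' hs' hne) hx hx'
  suffices h : ∀ S' ⊆ S, ∃ Γ : C(unitInterval, Plane), Γ 0 = γ 0 ∧ Γ 1 = γ 1 ∧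
      (∀ x ∈ Set.range Γ, x ∈ Set.range γ ∨ ∃ s ∈ S', x ∈ Metric.closedBall s r) ∧
      ∀ s ∈ S', StraightAt γ Γ r s from h S subset_rfl
  classical
  intro S'
  induction S' using Finset.induction_on with
  | empty =>
    intro _
    exact ⟨γ, rfl, rfl, fun x hx => Or.inl hx, by simp⟩
  | insert s S' hs ih =>
    intro hsub
    obtain ⟨hsS, hsub'⟩ := Finset.insert_subset_iff.1 hsub
    obtain ⟨Γ, hΓ0, hΓ1, hcov, hst⟩ := ih hsub'
    by_cases hne : ∃ t, Γ t ∈ Metric.closedBall s r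
    swap
    · refine ⟨Γ, hΓ0, hΓ1, fun x hx => (hcov x hx).imp id fun ⟨z, hz, hxz⟩ =>
        ⟨z, Finset.mem_insert_of_mem hz, hxz⟩, fun z hz => ?_⟩
      rcases Finset.mem_insert.1 hz with rfl | hz
      · left
        rw [Set.disjoint_left]
        rintro _ ⟨t, rfl⟩ ht
        exact hne ⟨t, ht⟩
      · exact hst z hz
    obtain ⟨Γ', a, b, h0', h1', ha, hb, ha0, hb1, ha', hb', hrange⟩ :=
      exists_replace_by_chord Γ s r hne
    have hchord : segment ℝ (Γ a) (Γ b) ⊆ Metric.closedBall s r :=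
      (convex_closedBall s r).segment_subset ha hb
    -- Only the disks around `S'` have been changed so far, and they are disjoint from this one.
    have hγ : ∀ t, Γ t ∈ Metric.closedBall s r → Γ t ∈ Set.range γ := fun t ht => by
      rcases hcov (Γ t) ⟨t, rfl⟩ with h | ⟨z, hz, hxz⟩
      · exact h
      · exact absurd (huniq s hsS z (hsub' hz) _ ht hxz ▸ hz) hs
    have hinS : Set.range Γ' ∩ Metric.closedBall s r ⊆ segment ℝ (Γ a) (Γ b) := fun x hx =>
      (hrange hx.1).resolve_left fun h => h.2 hx.2
    have ha00 : a = 0 → γ 0 = s := fun h => by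
      rw [h, hΓ0] at ha
      exact huniq _ h0 _ hsS _ (hself _) ha
    have hb11 : b = 1 → γ 1 = s := fun h => by
      rw [h, hΓ1] at hb
      exact huniq _ h1 _ hsS _ (hself _) hb
    refine ⟨Γ', h0'.trans hΓ0, h1'.trans hΓ1, fun x hx => ?_, fun z hz => ?_⟩
    · rcases hrange hx with h | h
      · exact (hcov x h.1).imp id fun ⟨z, hz, hxz⟩ => ⟨z, Finset.mem_insert_of_mem hz, hxz⟩
      · exact Or.inr ⟨s, Finset.mem_insert_self _ _, hchord h⟩
    · rcases Finset.mem_insert.1 hz with rfl | hz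
      · right
        by_cases hz0 : z = γ 0
        · have hb1' : b ≠ 1 := fun h => h01 (hz0.symm.trans (hb11 h).symm)
          refine ⟨Γ a, Γ b, hinS, hγ b hb, hb'.resolve_left hb1', fun _ => ?_,
            fun h => absurd hz0 h⟩
          rw [ha0 (by rw [hΓ0, ← hz0]; exact hself _), hΓ0, hz0]
        by_cases hz1 : z = γ 1
        · have ha0' : a ≠ 0 := fun h => hz0 (ha00 h).symm
          refine ⟨Γ b, Γ a, by rwa [segment_symm], hγ a ha, ha'.resolve_left ha0', fun _ => ?_,
            fun _ h => absurd hz1 h⟩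
          rw [hb1 (by rw [hΓ1, ← hz1]; exact hself _), hΓ1, hz1]
        · exact ⟨Γ a, Γ b, hinS, hγ b hb, hb'.resolve_left fun h => hz1 (hb11 h).symm,
            fun h => (h.elim hz0 hz1).elim, fun _ _ => ⟨hγ a ha,
              ha'.resolve_left fun h => hz0 (ha00 h).symm⟩⟩
      · have hzs : Disjoint (Metric.closedBall s r) (Metric.closedBall z r) :=
          hdis s hsS z (hsub' hz) (fun h => hs (h ▸ hz))
        have hold : Set.range Γ' ∩ Metric.closedBall z r ⊆ Set.range Γ ∩ Metric.closedBall z r := by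
          rintro x ⟨hx, hxz⟩
          rcases hrange hx with h | h
          · exact ⟨h.1, hxz⟩
          · exact absurd hxz (Set.disjoint_left.1 hzs (hchord h))
        rcases hst z hz with h | ⟨x, y, hxy, hrest⟩
        · left
          rw [Set.disjoint_iff_inter_eq_empty] at h ⊢
          exact Set.subset_empty_iff.1 (h ▸ hold)
        · exact Or.inr ⟨x, y, hold.trans hxy, hrest⟩

/-! ### Simple polygonal lines from shortest paths -/

/-- The graph on the points of `K` that joins points at distance less than `δ`. -/
def hopGraph (K : Set Plane) (δ : ℝ) : SimpleGraph Plane where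
  Adj x y := x ≠ y ∧ x ∈ K ∧ y ∈ K ∧ dist x y < δ
  symm := ⟨fun x y h => ⟨h.1.symm, h.2.2.1, h.2.1, dist_comm x y ▸ h.2.2.2⟩⟩

/-- A nontrivial connected set has no isolated points, so `C \ Z` is dense in `C`. Three distances
below `δ / 3` make one hop, and connectedness of `C` extends this local statement to all pairs of
points. -/
lemma hopGraph_reachable {C Z : Set Plane} (hC : IsPreconnected C) (hZ : Z.Finite) {u v : Plane}
    (hu : u ∈ C \ Z) (hv : v ∈ C \ Z) (huv : u ≠ v) {δ : ℝ} (hδ : 0 < δ) :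
    (hopGraph (C \ Z) δ).Reachable u v := by
  have hdense : ∀ x ∈ C, ∃ y ∈ C \ Z, dist x y < δ / 3 := by
    intro x hx
    by_cases hxZ : x ∈ Z
    · have hacc := hC.preperfect_of_nontrivial ⟨u, hu.1, v, hv.1, huv⟩ x hx
      have hU : Metric.ball x (δ / 3) ∩ (Z \ {x})ᶜ ∈ 𝓝 x :=
        Filter.inter_mem (Metric.ball_mem_nhds x (by positivity))
          ((hZ.subset Set.sdiff_subset).isClosed.isOpen_compl.mem_nhds (by simp))
      obtain ⟨y, ⟨⟨hy1, hy2⟩, hyC⟩, hyx⟩ := (accPt_iff_nhds.1 hacc) _ hU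
      refine ⟨y, ⟨hyC, fun hyZ => hy2 ⟨hyZ, hyx⟩⟩, ?_⟩
      rwa [dist_comm]
    · exact ⟨x, ⟨hx, hxZ⟩, by simpa using hδ⟩
  have key := hC.induction₂ (fun x y => ∀ x' ∈ C \ Z, ∀ y' ∈ C \ Z, dist x x' < δ / 3 →
      dist y y' < δ / 3 → (hopGraph (C \ Z) δ).Reachable x' y') ?_ ?_ ?_ hu.1 hv.1
  · exact key u hu v hv (by simpa using hδ) (by simpa using hδ)
  · intro x hx
    filter_upwards [nhdsWithin_le_nhds (Metric.ball_mem_nhds x (show 0 < δ / 3 by positivity))]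
      with y hy x' hx' y' hy' h1 h2
    rw [Metric.mem_ball, dist_comm] at hy
    by_cases hne : x' = y'
    · rw [hne]
    · refine SimpleGraph.Adj.reachable ⟨hne, hx', hy', ?_⟩
      have := dist_triangle4 x' x y y'
      rw [dist_comm x' x] at this
      linarith
  · intro x y z _ hy _ hxy hyz x' hx' z' hz' h1 h2
    obtain ⟨y', hy', h3⟩ := hdense y hy
    exact (hxy x' hx' y' hy' h1 h3).trans (hyz y' hy' z' hz' h3 h2)
  · intro x y _ _ h x' hx' y' hy' h1 h2
    exact (h y' hy' x' hx' h2 h1).symm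

/-- Two points of a connected set are joined by a simple polygonal line with corners in this set
and short sides. -/
lemma exists_simple_polyline {C Z : Set Plane} (hC : IsPreconnected C) (hZ : Z.Finite)
    {u v : Plane} (hu : u ∈ C \ Z) (hv : v ∈ C \ Z) (huv : u ≠ v) {δ : ℝ} (hδ : 0 < δ)
    (hδ' : δ ≤ dist u v) :
    ∃ P : Polyline, P.IsSimple ∧ P.pt 0 = u ∧ P.pt P.len = v ∧
      (∀ i ≤ P.len, P.pt i ∈ C \ Z) ∧ ∀ i < P.len, dist (P.pt i) (P.pt (i + 1)) < δ := by
  obtain ⟨p, hpath, hp⟩ := (hopGraph_reachable hC hZ hu hv huv hδ).exists_path_of_dist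
  have hadj : ∀ i < p.length, (hopGraph (C \ Z) δ).Adj (p.getVert i) (p.getVert (i + 1)) :=
    fun i hi => p.adj_getVert_succ hi
  have hmem : ∀ i ≤ p.length, p.getVert i ∈ C \ Z := by
    intro i hi
    rcases hi.eq_or_lt with rfl | h
    · rwa [p.getVert_length]
    · exact (hadj i h).2.1
  have hinj : ∀ i ≤ p.length, ∀ j ≤ p.length, p.getVert i = p.getVert j → i = j :=
    fun i hi j hj h => hpath.getVert_injOn hi hj h
  -- Two corners that are not consecutive and closer than `δ` would give a shortcut in a shortest
  -- path.
  have hshort : ∀ i j, i + 1 < j → j ≤ p.length → δ ≤ dist (p.getVert i) (p.getVert j) := by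
    intro i j hij hj
    by_contra! hlt
    have hA : (hopGraph (C \ Z) δ).Adj (p.getVert i) (p.getVert j) :=
      ⟨fun h => by have := hinj i (by omega) j hj h; omega, hmem i (by omega), hmem j hj, hlt⟩
    have := SimpleGraph.dist_le ((p.take i).append (SimpleGraph.Walk.cons hA (p.drop j)))
    rw [SimpleGraph.Walk.length_append, SimpleGraph.Walk.length_cons,
      SimpleGraph.Walk.take_length, SimpleGraph.Walk.drop_length] at this
    omega
  refine ⟨⟨p.length, p.getVert⟩, ⟨?_, fun i hi => (hadj i hi).1, ?_, ?_⟩, p.getVert_zero,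
    p.getVert_length, hmem, fun i hi => (hadj i hi).2.2.2⟩
  · change 2 ≤ p.length
    by_contra! h
    have h0 := p.getVert_zero
    have h1 := p.getVert_length
    rcases (by omega : p.length = 0 ∨ p.length = 1) with h' | h'
    · rw [h'] at h1
      exact huv (h0.symm.trans h1)
    · have := (hadj 0 (by omega)).2.2.2
      rw [h'] at h1
      rw [zero_add, h0, h1] at this
      linarith
  · intro i j hij hj
    change j < p.length at hj
    -- Two sides through `x` have total length below `2 * δ`, whereas both their first corners and
    -- their second corners have distance at least `δ`.
    rw [Set.disjoint_left]
    intro x hx hx'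
    have e1 := dist_add_dist_of_mem_segment hx
    have e2 := dist_add_dist_of_mem_segment hx'
    simp only at e1 e2
    have d1 := (hadj i (by omega)).2.2.2
    have d2 := (hadj j hj).2.2.2
    have s1 := hshort i j hij hj.le
    have s2 := hshort (i + 1) (j + 1) (by omega) (by omega)
    have t1 := dist_triangle (p.getVert i) x (p.getVert j)
    have t2 := dist_triangle (p.getVert (i + 1)) x (p.getVert (j + 1))
    rw [dist_comm x (p.getVert j)] at t1
    rw [dist_comm (p.getVert (i + 1)) x] at t2
    linarith
  · intro i hi
    change i + 1 < p.length at hi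
    rintro x ⟨hx, hx'⟩
    by_contra hne
    simp only [Polyline.side] at hx hx'
    rw [segment_symm] at hx
    obtain ⟨s, s0, s1, hs⟩ := Plane.mem_segment_iff.1 hx
    obtain ⟨t, t0, t1, ht⟩ := Plane.mem_segment_iff.1 hx'
    have d1 := (hadj i (by omega)).2.2.2
    have d2 := (hadj (i + 1) hi).2.2.2
    have s1 := hshort i (i + 2) (by omega) (by omega)
    rw [dist_eq_norm] at d1 s1
    rw [dist_comm, dist_eq_norm] at d2
    set b := p.getVert (i + 1)
    set v := p.getVert i - b with hv
    set w := p.getVert (i + 1 + 1) - b with hw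
    have hst : s • v = t • w := by
      rw [hs] at ht; exact add_left_cancel ht
    have hs0 : 0 < s := by
      refine lt_of_le_of_ne s0 fun h => hne ?_
      rw [hs, ← h, zero_smul, add_zero]; rfl
    have ht0 : 0 < t := by
      refine lt_of_le_of_ne t0 fun h => hne ?_
      rw [ht, ← h, zero_smul, add_zero]; rfl
    have hvw : v = (t / s) • w := by
      rw [div_eq_inv_mul, mul_smul, ← hst, smul_smul, inv_mul_cancel₀ hs0.ne', one_smul]
    have hc : 0 < t / s := by positivity
    -- If the sides overlap, `v` and `w` lie on one ray; both are shorter than `δ`, so their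
    -- difference is too.
    have hnorm : ‖v - w‖ < δ := by
      have h1 : ‖v‖ = (t / s) * ‖w‖ := by
        conv_lhs => rw [hvw]
        rw [norm_smul, Real.norm_of_nonneg hc.le]
      have h2 : ‖v - w‖ = |t / s - 1| * ‖w‖ := by
        have : v - w = (t / s - 1) • w := by
          rw [sub_smul, one_smul, ← hvw]
        rw [this, norm_smul, Real.norm_eq_abs]
      have h3 := norm_nonneg w
      rw [h2]
      rcases abs_cases (t / s - 1) with ⟨h, _⟩ | ⟨h, _⟩ <;> rw [h] <;> nlinarith
    have : v - w = p.getVert i - p.getVert (i + 2) := by rw [hv, hw]; abel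
    rw [this] at hnorm
    linarith

/-! ### Chords and radii of a circle -/

namespace Plane

lemma mem_sphere_iff {x s : Plane} {r : ℝ} (hr : 0 ≤ r) :
    x ∈ Metric.sphere s r ↔ (x 0 - s 0) ^ 2 + (x 1 - s 1) ^ 2 = r ^ 2 := by
  rw [Metric.mem_sphere, EuclideanSpace.dist_eq, Fin.sum_univ_two, Real.dist_eq, Real.dist_eq,
    sq_abs, sq_abs, Real.sqrt_eq_iff_eq_sq (by positivity) hr]

lemma mem_ball_or_eq_of_mem_chord {a b s x : Plane} {r : ℝ} (hr : r ≠ 0)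
    (ha : a ∈ Metric.sphere s r) (hb : b ∈ Metric.sphere s r) (hx : x ∈ segment ℝ a b) :
    x ∈ Metric.ball s r ∨ x = a ∨ x = b := by
  by_cases hab : a = b
  · subst hab; rw [segment_same] at hx; exact Or.inr (Or.inl hx)
  · rw [← insert_endpoints_openSegment] at hx
    rcases hx with h | h | h
    · exact Or.inr (Or.inl h)
    · exact Or.inr (Or.inr h)
    · left
      rw [← interior_closedBall _ hr]
      exact (strictConvex_closedBall ℝ s r).openSegment_subset
        (Metric.sphere_subset_closedBall ha) (Metric.sphere_subset_closedBall hb) hab h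

/-- A line intersects a circle in at most two points. -/
lemma eq_or_eq_of_mem_sphere {a b c s : Plane} {r w : ℝ} (hr : 0 ≤ r)
    (ha : a ∈ Metric.sphere s r) (hb : b ∈ Metric.sphere s r) (hc : c ∈ Metric.sphere s r)
    (h : c = a + w • (b - a)) : c = a ∨ c = b := by
  rw [mem_sphere_iff hr] at ha hb hc
  have h0 : c 0 = a 0 + w * (b 0 - a 0) := by rw [h]; simp
  have h1 : c 1 = a 1 + w * (b 1 - a 1) := by rw [h]; simp
  -- From `‖c - s‖² = (1 - w) ‖a - s‖² + w ‖b - s‖² - w (1 - w) ‖b - a‖²`, where the first three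
  -- norms are equal to `r`.
  have key : w * (w - 1) * ((b 0 - a 0) ^ 2 + (b 1 - a 1) ^ 2) = 0 := by
    rw [h0, h1] at hc
    linear_combination hc - (1 - w) * ha - w * hb
  rcases mul_eq_zero.1 key with h' | h'
  · rcases mul_eq_zero.1 h' with h' | h'
    · left; rw [h, h']; simp
    · right; rw [h, sub_eq_zero.1 h']; simp
  · left
    have e0 : b 0 - a 0 = 0 := by nlinarith [sq_nonneg (b 0 - a 0), sq_nonneg (b 1 - a 1)]
    have e1 : b 1 - a 1 = 0 := by nlinarith [sq_nonneg (b 0 - a 0), sq_nonneg (b 1 - a 1)]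
    ext i
    fin_cases i
    · simp [h0, e0]
    · simp [h1, e1]

/-- Two chords of a circle without common ends intersect in at most one point. -/
lemma chord_inter {a b c d s : Plane} {r : ℝ} (hr : 0 < r)
    (ha : a ∈ Metric.sphere s r) (hb : b ∈ Metric.sphere s r) (hc : c ∈ Metric.sphere s r)
    (hd : d ∈ Metric.sphere s r) (hac : a ≠ c) (had : a ≠ d) (hbc : b ≠ c) (hbd : b ≠ d) :
    (segment ℝ a b ∩ segment ℝ c d).Subsingleton ∧
      segment ℝ a b ∩ segment ℝ c d ⊆ Metric.ball s r := by
  constructor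
  · rintro x ⟨hx, hx'⟩ y ⟨hy, hy'⟩
    -- Two common points would put `c` on the line through `a` and `b`, which meets the circle only
    -- there.
    by_contra hne
    obtain ⟨t, -, -, ht⟩ := mem_segment_iff.1 hx
    obtain ⟨t', -, -, ht'⟩ := mem_segment_iff.1 hx'
    obtain ⟨u, -, -, hu⟩ := mem_segment_iff.1 hy
    obtain ⟨u', -, -, hu'⟩ := mem_segment_iff.1 hy'
    have hne' : u' - t' ≠ 0 := fun h => hne (by rw [ht', hu', sub_eq_zero.1 h])
    have e1 : (u' - t') • (d - c) = (u - t) • (b - a) := by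
      have e2 : y - x = (u' - t') • (d - c) := by rw [ht', hu']; module
      have e3 : y - x = (u - t) • (b - a) := by rw [ht, hu]; module
      rw [← e2, e3]
    have e4 : d - c = ((u - t) / (u' - t')) • (b - a) := by
      rw [div_eq_inv_mul, mul_smul, ← e1, smul_smul, inv_mul_cancel₀ hne', one_smul]
    have e5 : c = a + (t - t' * ((u - t) / (u' - t'))) • (b - a) := by
      have : c = x - t' • (d - c) := by rw [ht']; module
      rw [this, e4, ht]; module
    rcases eq_or_eq_of_mem_sphere hr.le ha hb hc e5 with h | h
    · exact hac h.symm
    · exact hbc h.symm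
  · rintro x ⟨hx, hx'⟩
    rcases mem_ball_or_eq_of_mem_chord hr.ne' ha hb hx with h | h
    · exact h
    rcases mem_ball_or_eq_of_mem_chord hr.ne' hc hd hx' with h' | h'
    · exact h'
    rcases h with rfl | rfl <;> rcases h' with rfl | rfl <;> contradiction

lemma radius_inter {a b s : Plane} {r : ℝ} (hr : 0 < r)
    (ha : a ∈ Metric.sphere s r) (hb : b ∈ Metric.sphere s r) (hab : a ≠ b) :
    segment ℝ s a ∩ segment ℝ s b ⊆ {s} := by
  rintro x ⟨hx, hx'⟩
  obtain ⟨t, t0, -, ht⟩ := mem_segment_iff.1 hx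
  obtain ⟨u, u0, -, hu⟩ := mem_segment_iff.1 hx'
  rw [mem_sphere_iff_norm] at ha hb
  have e : t • (a - s) = u • (b - s) := by
    rw [ht] at hu; exact add_left_cancel hu
  have htu : t = u := by
    have := congrArg norm e
    rw [norm_smul, norm_smul, ha, hb, Real.norm_of_nonneg t0, Real.norm_of_nonneg u0] at this
    exact mul_right_cancel₀ hr.ne' this
  rw [htu] at e
  rcases eq_or_ne u 0 with h | h
  · rw [hu, h]; simp
  · exact absurd (sub_left_injective (smul_right_injective _ h e)) hab

/-- Parallel segments with a common inner point have more common points. -/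
lemma not_subsingleton_of_cross_eq_zero {a b c d w : Plane} (h : cross (b - a) (d - c) = 0)
    (hw : w ∈ segment ℝ a b) (hw' : w ∈ segment ℝ c d) (ha : w ≠ a) (hb : w ≠ b) (hc : w ≠ c)
    (hd : w ≠ d) : ¬(segment ℝ a b ∩ segment ℝ c d).Subsingleton := by
  obtain ⟨t, t0, t1, ht⟩ := mem_segment_iff.1 hw
  obtain ⟨u, u0, u1, hu⟩ := mem_segment_iff.1 hw'
  have t0' : 0 < t := lt_of_le_of_ne t0 fun h => ha (by rw [ht, ← h]; simp)
  have t1' : t < 1 := lt_of_le_of_ne t1 fun h => hb (by rw [ht, h]; simp)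
  have u0' : 0 < u := lt_of_le_of_ne u0 fun h => hc (by rw [hu, ← h]; simp)
  have u1' : u < 1 := lt_of_le_of_ne u1 fun h => hd (by rw [hu, h]; simp)
  have hab : b - a ≠ 0 := fun h => ha (by rw [ht, h]; simp)
  have hcd : d - c ≠ 0 := fun h => hc (by rw [hu, h]; simp)
  have e := eq_smul_of_cross_eq_zero hab h
  set k := inner ℝ (b - a) (d - c) / inner ℝ (b - a) (b - a)
  have hk : k ≠ 0 := fun h => hcd (by rw [e, h, zero_smul])
  have h1 : ∀ᶠ η in 𝓝 (0 : ℝ), t + η < 1 := by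
    have : Continuous fun η : ℝ => t + η := by fun_prop
    exact this.continuousAt.eventually_lt continuousAt_const (by simpa using t1')
  have h2 : ∀ᶠ η in 𝓝 (0 : ℝ), u + η / k < 1 := by
    have : Continuous fun η : ℝ => u + η / k := by fun_prop
    exact this.continuousAt.eventually_lt continuousAt_const (by simpa using u1')
  have h3 : ∀ᶠ η in 𝓝 (0 : ℝ), 0 < u + η / k := by
    have : Continuous fun η : ℝ => u + η / k := by fun_prop
    exact continuousAt_const.eventually_lt this.continuousAt (by simpa using u0')
  obtain ⟨η, ⟨h1, h2, h3⟩, hη : 0 < η⟩ :=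
    (((h1.and (h2.and h3)).filter_mono nhdsWithin_le_nhds).and
      (self_mem_nhdsWithin : ∀ᶠ η in 𝓝[>] (0 : ℝ), η ∈ Set.Ioi 0)).exists
  intro hsub
  have hmem : w + η • (b - a) ∈ segment ℝ a b ∩ segment ℝ c d := by
    constructor
    · exact mem_segment_iff.2 ⟨t + η, by linarith, h1.le, by rw [ht]; module⟩
    · refine mem_segment_iff.2 ⟨u + η / k, h3.le, h2.le, ?_⟩
      rw [add_smul, div_eq_mul_inv, mul_smul, e, smul_smul k⁻¹, inv_mul_cancel₀ hk, one_smul,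
        ← e, hu]
      module
  have := hsub hmem ⟨hw, hw'⟩
  rw [add_eq_left] at this
  exact (smul_ne_zero hη.ne' hab) this

end Plane

/-! ### From arbitrary curves to polygonal lines -/

/-- A finite system of curves with ends in the finite set `V`, which contain no other points of `V`
and any two of which have finitely many common points, while no three have a common point outside
`V`. -/
structure ArcSystem {β : Type*} (E : Set β) (V : Set Plane)
    (γ : β → C(unitInterval, Plane)) : Prop where
  finite_edges : E.Finite
  finite_vertices : V.Finite
  first_mem : ∀ e ∈ E, γ e 0 ∈ V
  last_mem : ∀ e ∈ E, γ e 1 ∈ V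
  ends_ne : ∀ e ∈ E, γ e 0 ≠ γ e 1
  eq_of_mem : ∀ e ∈ E, ∀ x ∈ V, x ∈ Set.range (γ e) → x = γ e 0 ∨ x = γ e 1
  finite_inter : ∀ e ∈ E, ∀ f ∈ E, e ≠ f → (Set.range (γ e) ∩ Set.range (γ f)).Finite
  no_three : ∀ e ∈ E, ∀ f ∈ E, ∀ g ∈ E, e ≠ f → e ≠ g → f ≠ g →
    Set.range (γ e) ∩ Set.range (γ f) ∩ Set.range (γ g) ⊆ V

namespace ArcSystem

variable {β : Type*} {E : Set β} {V : Set Plane} {γ : β → C(unitInterval, Plane)}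

/-- The points of `V` and the common points of two curves. -/
def nodes (E : Set β) (V : Set Plane) (γ : β → C(unitInterval, Plane)) : Set Plane :=
  V ∪ ⋃ e ∈ E, ⋃ f ∈ E, ⋃ _ : e ≠ f, Set.range (γ e) ∩ Set.range (γ f)

lemma mem_nodes {e f : β} (he : e ∈ E) (hf : f ∈ E) (hef : e ≠ f) {x : Plane}
    (hx : x ∈ Set.range (γ e)) (hx' : x ∈ Set.range (γ f)) : x ∈ nodes E V γ := by
  refine Or.inr ?_
  simp only [Set.mem_iUnion]
  exact ⟨e, he, f, hf, hef, hx, hx'⟩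

lemma finite_nodes (h : ArcSystem E V γ) : (nodes E V γ).Finite := by
  refine h.finite_vertices.union (h.finite_edges.biUnion fun e he =>
    h.finite_edges.biUnion fun f hf => Set.finite_iUnion fun hef => h.finite_inter e he f hf hef)

lemma exists_radius (h : ArcSystem E V γ) :
    ∃ r > 0, (∀ s ∈ nodes E V γ, ∀ s' ∈ nodes E V γ, s ≠ s' →
        Disjoint (Metric.closedBall s r) (Metric.closedBall s' r)) ∧
      ∀ e ∈ E, ∀ s ∈ nodes E V γ, s ∉ Set.range (γ e) →
        Disjoint (Set.range (γ e)) (Metric.closedBall s r) := by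
  have h1 : ∀ᶠ r in 𝓝[>] (0 : ℝ), ∀ s ∈ nodes E V γ, ∀ s' ∈ nodes E V γ, s ≠ s' →
      Disjoint (Metric.closedBall s r) (Metric.closedBall s' r) := by
    refine (Filter.eventually_all_finite h.finite_nodes).2 fun s _ =>
      (Filter.eventually_all_finite h.finite_nodes).2 fun s' _ => ?_
    by_cases hs : s = s'
    · simp [hs]
    · have hc : Continuous fun r : ℝ => r + r := by fun_prop
      have := hc.continuousAt.eventually_lt (x₀ := 0) continuousAt_const
        (show (0 : ℝ) + 0 < dist s s' by simpa using hs)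
      filter_upwards [nhdsWithin_le_nhds this] with r hr _
      exact Metric.closedBall_disjoint_closedBall hr
  have h2 : ∀ᶠ r in 𝓝[>] (0 : ℝ), ∀ e ∈ E, ∀ s ∈ nodes E V γ, s ∉ Set.range (γ e) →
      Disjoint (Set.range (γ e)) (Metric.closedBall s r) := by
    refine (Filter.eventually_all_finite h.finite_edges).2 fun e _ =>
      (Filter.eventually_all_finite h.finite_nodes).2 fun s _ => ?_
    by_cases hs : s ∈ Set.range (γ e)
    · simp [hs]
    · have hopen : IsOpen (Set.range (γ e))ᶜ :=
        (isCompact_range (γ e).continuous).isClosed.isOpen_compl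
      obtain ⟨ρ, hρ, hsub⟩ := Metric.isOpen_iff.1 hopen s hs
      filter_upwards [nhdsWithin_le_nhds (Iio_mem_nhds hρ)] with r hr _
      rw [Set.disjoint_right]
      exact fun x hx => hsub (Metric.closedBall_subset_ball hr hx)
  obtain ⟨r, ⟨h1, h2⟩, hr⟩ := ((h1.and h2).and self_mem_nhdsWithin).exists
  exact ⟨r, hr, h1, h2⟩

/-- The curves of an arc system after they were made straight near the nodes. The set `C e s`
contains the part of `Γ e` near the node `s`. -/
structure IsStraightening (E : Set β) (V : Set Plane) (γ Γ : β → C(unitInterval, Plane)) (r : ℝ)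
    (C : β → Plane → Set Plane) : Prop where
  pos : 0 < r
  disjoint : ∀ s ∈ nodes E V γ, ∀ s' ∈ nodes E V γ, s ≠ s' →
    Disjoint (Metric.closedBall s r) (Metric.closedBall s' r)
  first : ∀ e ∈ E, Γ e 0 = γ e 0
  last : ∀ e ∈ E, Γ e 1 = γ e 1
  cover : ∀ e ∈ E, ∀ x ∈ Set.range (Γ e), x ∈ Set.range (γ e) ∨
    ∃ s ∈ nodes E V γ, x ∈ Metric.closedBall s r
  convex : ∀ e ∈ E, ∀ s ∈ nodes E V γ, Convex ℝ (C e s)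
  subset : ∀ e ∈ E, ∀ s ∈ nodes E V γ, Set.range (Γ e) ∩ Metric.closedBall s r ⊆ C e s
  node_mem : ∀ e ∈ E, ∀ s ∈ nodes E V γ, (C e s).Nonempty → s ∈ Set.range (γ e)
  subsingleton : ∀ e ∈ E, ∀ f ∈ E, e ≠ f → ∀ s ∈ nodes E V γ, (C e s ∩ C f s).Subsingleton
  inter_subset : ∀ e ∈ E, ∀ f ∈ E, e ≠ f → ∀ s ∈ nodes E V γ, C e s ∩ C f s ⊆ Metric.ball s r
  inter_vertex : ∀ e ∈ E, ∀ f ∈ E, e ≠ f → ∀ s ∈ V, C e s ∩ C f s ⊆ {s}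

/-- Around every node take a disk so small that the disks are disjoint and avoid the curves that do
not pass through their node. No node lies on a circle, so different curves have no common point
there; thus their chords have no common ends and meet at most once, and their radii meet only in the
centre. -/
lemma exists_isStraightening (h : ArcSystem E V γ) :
    ∃ Γ r C, IsStraightening E V γ Γ r C := by
  obtain ⟨r, hr, hdis, hfar⟩ := h.exists_radius
  have hV : V ⊆ nodes E V γ := Set.subset_union_left
  have hself : ∀ s : Plane, s ∈ Metric.closedBall s r := fun s => Metric.mem_closedBall_self hr.le
  have huniq : ∀ s ∈ nodes E V γ, ∀ s' ∈ nodes E V γ, ∀ x, x ∈ Metric.closedBall s r →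
      x ∈ Metric.closedBall s' r → s = s' := fun s hs s' hs' x hx hx' => by
    by_contra hne
    exact Set.disjoint_left.1 (hdis s hs s' hs' hne) hx hx'
  have hex : ∀ e, ∃ Γ : C(unitInterval, Plane), e ∈ E → Γ 0 = γ e 0 ∧ Γ 1 = γ e 1 ∧
      (∀ x ∈ Set.range Γ, x ∈ Set.range (γ e) ∨ ∃ s ∈ nodes E V γ, x ∈ Metric.closedBall s r) ∧
      ∀ s ∈ nodes E V γ, StraightAt (γ e) Γ r s := by
    intro e
    by_cases he : e ∈ E
    · obtain ⟨Γ, hΓ⟩ := exists_straight (γ e) h.finite_nodes.toFinset r hr (by simpa using hdis)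
        (by simpa using hV (h.first_mem e he)) (by simpa using hV (h.last_mem e he))
        (h.ends_ne e he)
      exact ⟨Γ, fun _ => by simpa using hΓ⟩
    · exact ⟨γ e, fun h' => absurd h' he⟩
  choose Γ hΓ using hex
  have hexC : ∀ e s, ∃ C : Set Plane, e ∈ E → s ∈ nodes E V γ →
      Convex ℝ C ∧ Set.range (Γ e) ∩ Metric.closedBall s r ⊆ C ∧
      (C.Nonempty → ∃ x y, C = segment ℝ x y ∧ y ∈ Set.range (γ e) ∧ y ∈ Metric.sphere s r ∧
        ((s = γ e 0 ∨ s = γ e 1) → x = s) ∧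
        (s ≠ γ e 0 → s ≠ γ e 1 → x ∈ Set.range (γ e) ∧ x ∈ Metric.sphere s r)) := by
    intro e s
    by_cases hes : e ∈ E ∧ s ∈ nodes E V γ
    · rcases (hΓ e hes.1).2.2.2 s hes.2 with hd | ⟨x, y, hxy, hrest⟩
      · exact ⟨∅, fun _ _ => ⟨convex_empty, hd.inter_eq.subset, by simp⟩⟩
      · exact ⟨segment ℝ x y, fun _ _ => ⟨convex_segment x y, hxy, fun _ => ⟨x, y, rfl, hrest⟩⟩⟩
    · exact ⟨∅, fun h1 h2 => absurd ⟨h1, h2⟩ hes⟩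
  choose C hC using hexC
  have hnode : ∀ e ∈ E, ∀ s ∈ nodes E V γ, (C e s).Nonempty → s ∈ Set.range (γ e) := by
    intro e he s hs hne
    obtain ⟨x, y, -, hy, hys, -⟩ := (hC e s he hs).2.2 hne
    by_contra hns
    exact Set.disjoint_left.1 (hfar e he s hs hns) hy (Metric.sphere_subset_closedBall hys)
  have hsphere : ∀ s ∈ nodes E V γ, ∀ x ∈ Metric.sphere s r, x ∉ nodes E V γ := by
    intro s hs x hx hxn
    have := huniq s hs x hxn x (Metric.sphere_subset_closedBall hx) (hself x)
    rw [this, Metric.mem_sphere, dist_self] at hx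
    exact hr.ne hx
  have hvert : ∀ e ∈ E, ∀ f ∈ E, e ≠ f → ∀ s ∈ V, C e s ∩ C f s ⊆ {s} := by
    rintro e he f hf hef s hs z ⟨hz, hz'⟩
    have hsn := hV hs
    obtain ⟨x, y, hCe, hy, hys, hx, -⟩ := (hC e s he hsn).2.2 ⟨z, hz⟩
    obtain ⟨x', y', hCf, hy', hys', hx', -⟩ := (hC f s hf hsn).2.2 ⟨z, hz'⟩
    have hxs := hx (h.eq_of_mem e he s hs (hnode e he s hsn ⟨z, hz⟩))
    have hxs' := hx' (h.eq_of_mem f hf s hs (hnode f hf s hsn ⟨z, hz'⟩))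
    rw [hCe, hxs] at hz
    rw [hCf, hxs'] at hz'
    refine Plane.radius_inter hr hys hys' (fun heq => ?_) ⟨hz, hz'⟩
    exact hsphere s hsn y hys (mem_nodes he hf hef hy (heq ▸ hy'))
  have hcross : ∀ e ∈ E, ∀ f ∈ E, e ≠ f → ∀ s ∈ nodes E V γ,
      (C e s ∩ C f s).Subsingleton ∧ C e s ∩ C f s ⊆ Metric.ball s r := by
    intro e he f hf hef s hs
    by_cases hsV : s ∈ V
    · have := hvert e he f hf hef s hsV
      refine ⟨Set.subsingleton_singleton.anti this, this.trans ?_⟩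
      simpa using hr
    rcases (C e s ∩ C f s).eq_empty_or_nonempty with hemp | ⟨z, hz, hz'⟩
    · rw [hemp]; exact ⟨Set.subsingleton_empty, Set.empty_subset _⟩
    obtain ⟨x, y, hCe, hy, hys, -, hx⟩ := (hC e s he hs).2.2 ⟨z, hz⟩
    obtain ⟨x', y', hCf, hy', hys', -, hx'⟩ := (hC f s hf hs).2.2 ⟨z, hz'⟩
    obtain ⟨hx, hxs⟩ := hx (fun heq => hsV (heq ▸ h.first_mem e he))
      (fun heq => hsV (heq ▸ h.last_mem e he))
    obtain ⟨hx', hxs'⟩ := hx' (fun heq => hsV (heq ▸ h.first_mem f hf))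
      (fun heq => hsV (heq ▸ h.last_mem f hf))
    have hne : ∀ p ∈ Metric.sphere s r, ∀ q, p ∈ Set.range (γ e) → q ∈ Set.range (γ f) → p ≠ q :=
      fun p hp q hpe hqf heq => hsphere s hs p hp (mem_nodes he hf hef hpe (heq ▸ hqf))
    rw [hCe, hCf]
    exact Plane.chord_inter hr hxs hys hxs' hys' (hne _ hxs _ hx hx') (hne _ hxs _ hx hy')
      (hne _ hys _ hy hx') (hne _ hys _ hy hy')
  exact ⟨Γ, r, C, hr, hdis, fun e he => (hΓ e he).1, fun e he => (hΓ e he).2.1,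
    fun e he => (hΓ e he).2.2.1, fun e he s hs => (hC e s he hs).1,
    fun e he s hs => (hC e s he hs).2.1, hnode,
    fun e he f hf hef s hs => (hcross e he f hf hef s hs).1,
    fun e he f hf hef s hs => (hcross e he f hf hef s hs).2, hvert⟩

namespace IsStraightening

variable {Γ : β → C(unitInterval, Plane)} {r : ℝ} {C : β → Plane → Set Plane}

lemma eq_of_mem_closedBall (H : IsStraightening E V γ Γ r C) {s s' x : Plane}
    (hs : s ∈ nodes E V γ) (hs' : s' ∈ nodes E V γ) (hx : x ∈ Metric.closedBall s r)
    (hx' : x ∈ Metric.closedBall s' r) : s = s' := by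
  by_contra hne
  exact Set.disjoint_left.1 (H.disjoint s hs s' hs' hne) hx hx'

/-- Outside the disks the curves are the original ones, whose common points are nodes; within a
disk, the sets `C e s` and `C f s` meet only in its interior. -/
lemma exists_mem_ball (H : IsStraightening E V γ Γ r C) {e f : β} (he : e ∈ E) (hf : f ∈ E)
    (hef : e ≠ f) {x : Plane} (hx : x ∈ Set.range (Γ e)) (hx' : x ∈ Set.range (Γ f)) :
    ∃ s ∈ nodes E V γ, x ∈ Metric.ball s r := by
  have key : ∀ s ∈ nodes E V γ, x ∈ Metric.closedBall s r →
      ∃ s ∈ nodes E V γ, x ∈ Metric.ball s r := fun s hs hxs =>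
    ⟨s, hs, H.inter_subset e he f hf hef s hs
      ⟨H.subset e he s hs ⟨hx, hxs⟩, H.subset f hf s hs ⟨hx', hxs⟩⟩⟩
  rcases H.cover e he x hx with h1 | ⟨s, hs, hxs⟩
  · rcases H.cover f hf x hx' with h2 | ⟨s, hs, hxs⟩
    · exact ⟨x, mem_nodes he hf hef h1 h2, Metric.mem_ball_self H.pos⟩
    · exact key s hs hxs
  · exact key s hs hxs

/-- A compactness argument. The constants fit sides shorter than `δ`: if two of them meet, their
first corners are closer than `2 * δ`, and all their corners are within `3 * δ` of the first one. -/
lemma eventually_near (H : IsStraightening E V γ Γ r C) {e f : β} (he : e ∈ E) (hf : f ∈ E)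
    (hef : e ≠ f) :
    ∀ᶠ δ in 𝓝 (0 : ℝ), ∀ z ∈ Set.range (Γ e) ×ˢ Set.range (Γ f), dist z.1 z.2 < 2 * δ →
      ∃ s ∈ nodes E V γ, dist z.1 s + 3 * δ < r := by
  refine ((isCompact_range (Γ e).continuous).prod
    (isCompact_range (Γ f).continuous)).eventually_forall_of_forall_eventually
    (P := fun (δ : ℝ) (z : Plane × Plane) => dist z.1 z.2 < 2 * δ →
      ∃ s ∈ nodes E V γ, dist z.1 s + 3 * δ < r) ?_
  rintro ⟨p, q⟩ ⟨hp, hq⟩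
  by_cases hpq : p = q
  · subst hpq
    obtain ⟨s, hs, hps⟩ := H.exists_mem_ball he hf hef hp hq
    have hc : Continuous fun y : ℝ × Plane × Plane => dist y.2.1 s + 3 * y.1 := by fun_prop
    have := hc.continuousAt.eventually_lt (x₀ := ((0 : ℝ), p, p)) (g := fun _ => r)
      continuousAt_const (by simpa using hps)
    filter_upwards [this] with y hy _
    exact ⟨s, hs, hy⟩
  · have hc : Continuous fun y : ℝ × Plane × Plane => 2 * y.1 := by fun_prop
    have hc' : Continuous fun y : ℝ × Plane × Plane => dist y.2.1 y.2.2 := by fun_prop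
    have := hc.continuousAt.eventually_lt (x₀ := ((0 : ℝ), p, q)) hc'.continuousAt
      (by simpa using hpq)
    filter_upwards [this] with y hy hlt
    exact absurd hlt (not_lt.2 hy.le)

/-- The common points of two of the sets `C e s` at the nodes `s` outside `V`. -/
def crossings (E : Set β) (V : Set Plane) (γ : β → C(unitInterval, Plane))
    (C : β → Plane → Set Plane) : Set Plane :=
  ⋃ e ∈ E, ⋃ f ∈ E, ⋃ _ : e ≠ f, ⋃ s ∈ nodes E V γ \ V, C e s ∩ C f s

lemma mem_crossings {e f : β} (he : e ∈ E) (hf : f ∈ E) (hef : e ≠ f) {s x : Plane}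
    (hs : s ∈ nodes E V γ) (hsV : s ∉ V) (hx : x ∈ C e s ∩ C f s) : x ∈ crossings E V γ C := by
  simp only [crossings, Set.mem_iUnion]
  exact ⟨e, he, f, hf, hef, s, ⟨hs, hsV⟩, hx⟩

lemma finite_crossings (h : ArcSystem E V γ) (H : IsStraightening E V γ Γ r C) :
    (crossings E V γ C).Finite :=
  h.finite_edges.biUnion fun e he => h.finite_edges.biUnion fun f hf =>
    Set.finite_iUnion fun hef => (h.finite_nodes.subset Set.sdiff_subset).biUnion fun s hs =>
      (H.subsingleton e he f hf hef s hs.1).finite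

/-- Corners will be chosen off the crossings; this keeps the ends of the curves available as
corners. -/
lemma notMem_crossings (H : IsStraightening E V γ Γ r C) {x : Plane} (hx : x ∈ V) :
    x ∉ crossings E V γ C := by
  intro hxc
  simp only [crossings, Set.mem_iUnion] at hxc
  obtain ⟨e, he, f, hf, hef, s, ⟨hs, hsV⟩, hxs⟩ := hxc
  have h1 := Metric.ball_subset_closedBall (H.inter_subset e he f hf hef s hs hxs)
  have h2 := H.eq_of_mem_closedBall hs (Or.inl hx) h1 (Metric.mem_closedBall_self H.pos.le)
  exact hsV (h2 ▸ hx)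

end IsStraightening

/-- Every finite system of curves can be replaced by a system of polygonal lines with the same ends
and no more crossings. -/
theorem exists_polygonalSystem (h : ArcSystem E V γ) :
    ∃ P : β → Polyline, PolygonalSystem E V P ∧
      (∀ e ∈ E, (P e).pt 0 = γ e 0 ∧ (P e).pt (P e).len = γ e 1) ∧
      ∀ e ∈ E, ∀ f ∈ E, e ≠ f → ∃ φ : ℕ × ℕ → Plane,
        Set.InjOn φ (crossingSides V (P e) (P f)) ∧
        Set.MapsTo φ (crossingSides V (P e) (P f))
          ((Set.range (γ e) ∩ Set.range (γ f)) \ V) := by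
  obtain ⟨Γ, r, C, H⟩ := h.exists_isStraightening
  have hV : V ⊆ nodes E V γ := Set.subset_union_left
  set Z := IsStraightening.crossings E V γ C with hZdef
  have hδ1 : ∀ᶠ δ in 𝓝 (0 : ℝ), ∀ e ∈ E, ∀ f ∈ E, e ≠ f →
      ∀ z ∈ Set.range (Γ e) ×ˢ Set.range (Γ f), dist z.1 z.2 < 2 * δ →
        ∃ s ∈ nodes E V γ, dist z.1 s + 3 * δ < r := by
    refine (Filter.eventually_all_finite h.finite_edges).2 fun e he =>
      (Filter.eventually_all_finite h.finite_edges).2 fun f hf => ?_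
    by_cases hef : e = f
    · simp [hef]
    · filter_upwards [H.eventually_near he hf hef] with δ hδ _
      exact hδ
  have hδ2 : ∀ᶠ δ in 𝓝 (0 : ℝ), ∀ e ∈ E, δ < dist (γ e 0) (γ e 1) :=
    (Filter.eventually_all_finite h.finite_edges).2 fun e he =>
      Iio_mem_nhds (dist_pos.2 (h.ends_ne e he))
  obtain ⟨δ, ⟨hδ1, hδ2, hδr⟩, hδ0 : 0 < δ⟩ :=
    (((hδ1.and (hδ2.and (Iio_mem_nhds H.pos))).filter_mono nhdsWithin_le_nhds).and
      (self_mem_nhdsWithin : ∀ᶠ η in 𝓝[>] (0 : ℝ), η ∈ Set.Ioi 0)).exists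
  have hδr : δ < r := hδr
  have hex : ∀ e, ∃ P : Polyline, e ∈ E → P.IsSimple ∧ P.pt 0 = γ e 0 ∧ P.pt P.len = γ e 1 ∧
      (∀ i ≤ P.len, P.pt i ∈ Set.range (Γ e) \ Z) ∧
      ∀ i < P.len, dist (P.pt i) (P.pt (i + 1)) < δ := by
    intro e
    by_cases he : e ∈ E
    · obtain ⟨P, hP⟩ := exists_simple_polyline (isPreconnected_range (Γ e).continuous)
        (IsStraightening.finite_crossings h H) (u := γ e 0) (v := γ e 1)
        ⟨⟨0, H.first e he⟩, H.notMem_crossings (h.first_mem e he)⟩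
        ⟨⟨1, H.last e he⟩, H.notMem_crossings (h.last_mem e he)⟩ (h.ends_ne e he) hδ0
        (hδ2 e he).le
      exact ⟨P, fun _ => hP⟩
    · exact ⟨⟨0, 0⟩, fun h' => absurd h' he⟩
  choose P hP using hex
  have hnear : ∀ e ∈ E, ∀ i < (P e).len, ∀ x ∈ (P e).side i, dist (P e |>.pt i) x < δ := by
    intro e he i hi x hx
    have := dist_add_dist_of_mem_segment hx
    have h2 := (hP e he).2.2.2.2 i hi
    have h3 : 0 ≤ dist x ((P e).pt (i + 1)) := dist_nonneg
    linarith
  -- The choice of `δ` puts all four corners of two meeting sides into the disk of one node `s`,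
  -- hence the sides into the convex sets `C e s` and `C f s`.
  have hlocal : ∀ e ∈ E, ∀ f ∈ E, e ≠ f → ∀ i < (P e).len, ∀ j < (P f).len,
      ∀ x ∈ (P e).side i ∩ (P f).side j,
        ∃ s ∈ nodes E V γ, (P e).side i ⊆ C e s ∧ (P f).side j ⊆ C f s := by
    rintro e he f hf hef i hi j hj x ⟨hx, hx'⟩
    have d1 := hnear e he i hi x hx
    have d2 := hnear f hf j hj x hx'
    have d3 := (hP e he).2.2.2.2 i hi
    have d4 := (hP f hf).2.2.2.2 j hj
    have m1 := (hP e he).2.2.2.1 i hi.le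
    have m2 := (hP e he).2.2.2.1 (i + 1) hi
    have m3 := (hP f hf).2.2.2.1 j hj.le
    have m4 := (hP f hf).2.2.2.1 (j + 1) hj
    have t1 := dist_triangle_right ((P e).pt i) ((P f).pt j) x
    obtain ⟨s, hs, hsr⟩ := hδ1 e he f hf hef ((P e).pt i, (P f).pt j) ⟨m1.1, m3.1⟩ (by
      change dist ((P e).pt i) ((P f).pt j) < 2 * δ
      linarith)
    simp only at hsr
    have t2 := dist_triangle_left ((P e).pt (i + 1)) s ((P e).pt i)
    have t3 := dist_triangle_left ((P f).pt j) s ((P e).pt i)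
    have t4 := dist_triangle_left ((P f).pt (j + 1)) s ((P f).pt j)
    refine ⟨s, hs, ?_, ?_⟩
    · refine (H.convex e he s hs).segment_subset
        (H.subset e he s hs ⟨m1.1, ?_⟩) (H.subset e he s hs ⟨m2.1, ?_⟩) <;>
      rw [Metric.mem_closedBall] <;> linarith
    · refine (H.convex f hf s hs).segment_subset
        (H.subset f hf s hs ⟨m3.1, ?_⟩) (H.subset f hf s hs ⟨m4.1, ?_⟩) <;>
      rw [Metric.mem_closedBall] <;> linarith
  have hcorner : ∀ e ∈ E, ∀ x ∈ Z, ∀ i ≤ (P e).len, x ≠ (P e).pt i := fun e he x hx i hi heq =>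
    ((hP e he).2.2.2.1 i hi).2 (heq ▸ hx)
  have hZ : ∀ e ∈ E, ∀ f ∈ E, e ≠ f → ∀ s ∈ nodes E V γ, ∀ x ∈ C e s ∩ C f s, x ∉ V →
      s ∉ V ∧ x ∈ Z := by
    intro e he f hf hef s hs x hx hxV
    have hsV : s ∉ V := fun hsV => hxV (H.inter_vertex e he f hf hef s hsV hx ▸ hsV)
    exact ⟨hsV, IsStraightening.mem_crossings he hf hef hs hsV hx⟩
  refine ⟨P, ⟨fun e he => (hP e he).1, fun e he => (hP e he).2.1 ▸ h.first_mem e he,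
    fun e he => (hP e he).2.2.1 ▸ h.last_mem e he, ?_, ?_, ?_, ?_⟩,
    fun e he => ⟨(hP e he).2.1, (hP e he).2.2.1⟩, ?_⟩
  · rintro e he x hx ⟨i, hi, hxi⟩
    rw [(hP e he).2.1, (hP e he).2.2.1]
    refine h.eq_of_mem e he x hx (H.node_mem e he x (hV hx) ⟨(P e).pt i, ?_⟩)
    refine H.subset e he x (hV hx) ⟨((hP e he).2.2.2.1 i hi.le).1, ?_⟩
    exact ((hnear e he i hi x hxi).trans hδr).le
  · intro e he f hf hef i hi j hj x hx y hy
    obtain ⟨s, hs, h1, h2⟩ := hlocal e he f hf hef i hi j hj x hx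
    exact H.subsingleton e he f hf hef s hs ⟨h1 hx.1, h2 hx.2⟩ ⟨h1 hy.1, h2 hy.2⟩
  · intro e he f hf hef i hi j hj x hx hxV hcross
    obtain ⟨s, hs, h1, h2⟩ := hlocal e he f hf hef i hi j hj x hx
    obtain ⟨hsV, hxZ⟩ := hZ e he f hf hef s hs x ⟨h1 hx.1, h2 hx.2⟩ hxV
    refine Plane.not_subsingleton_of_cross_eq_zero hcross hx.1 hx.2
      (hcorner e he x hxZ i hi.le) (hcorner e he x hxZ (i + 1) hi)
      (hcorner f hf x hxZ j hj.le) (hcorner f hf x hxZ (j + 1) hj) ?_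
    exact (H.subsingleton e he f hf hef s hs).anti (Set.inter_subset_inter h1 h2)
  · rintro e he f hf g hg hef heg hfg x ⟨⟨⟨i, hi, hxi⟩, ⟨j, hj, hxj⟩⟩, ⟨l, hl, hxl⟩⟩
    obtain ⟨s, hs, h1, h2⟩ := hlocal e he f hf hef i hi j hj x ⟨hxi, hxj⟩
    obtain ⟨s', hs', h1', h3⟩ := hlocal e he g hg heg i hi l hl x ⟨hxi, hxl⟩
    have hxef : x ∈ C e s ∩ C f s := ⟨h1 hxi, h2 hxj⟩
    obtain rfl : s = s' := H.eq_of_mem_closedBall hs hs'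
      (Metric.ball_subset_closedBall (H.inter_subset e he f hf hef s hs hxef))
      (Metric.ball_subset_closedBall (H.inter_subset e he g hg heg s' hs' ⟨h1' hxi, h3 hxl⟩))
    have hsV : s ∈ V := h.no_three e he f hf g hg hef heg hfg
      ⟨⟨H.node_mem e he s hs ⟨x, h1 hxi⟩, H.node_mem f hf s hs ⟨x, h2 hxj⟩⟩,
        H.node_mem g hg s hs ⟨x, h3 hxl⟩⟩
    exact H.inter_vertex e he f hf hef s hsV hxef ▸ hsV
  · intro e he f hf hef
    -- A crossing pair of sides is sent to its node, a common point of the original curves. A node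
    -- determines the point where the lines cross, and this point is not a corner, so it determines
    -- both sides.
    have hφ : ∀ z : ℕ × ℕ, ∃ s, z ∈ crossingSides V (P e) (P f) →
        s ∈ nodes E V γ ∧ (P e).side z.1 ⊆ C e s ∧ (P f).side z.2 ⊆ C f s := by
      intro z
      by_cases hz : z ∈ crossingSides V (P e) (P f)
      · obtain ⟨hi, hj, x, hx, -⟩ := hz
        obtain ⟨s, hs⟩ := hlocal e he f hf hef z.1 hi z.2 hj x hx
        exact ⟨s, fun _ => hs⟩
      · exact ⟨0, fun h' => absurd h' hz⟩
    choose φ hφ using hφ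
    refine ⟨φ, ?_, ?_⟩
    · intro z hz z' hz' heq
      obtain ⟨hs, h1, h2⟩ := hφ z hz
      obtain ⟨-, h1', h2'⟩ := hφ z' hz'
      rw [← heq] at h1' h2'
      obtain ⟨hi, hj, x, hx, hxV⟩ := hz
      obtain ⟨hi', hj', x', hx', -⟩ := hz'
      have hxs : x ∈ C e (φ z) ∩ C f (φ z) := ⟨h1 hx.1, h2 hx.2⟩
      obtain rfl : x = x' := H.subsingleton e he f hf hef _ hs hxs ⟨h1' hx'.1, h2' hx'.2⟩
      have hxZ := (hZ e he f hf hef _ hs x hxs hxV).2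
      exact Prod.ext ((hP e he).1.side_unique hi hi' hx.1 hx'.1 (hcorner e he x hxZ))
        ((hP f hf).1.side_unique hj hj' hx.2 hx'.2 (hcorner f hf x hxZ))
    · intro z hz
      obtain ⟨hs, h1, h2⟩ := hφ z hz
      obtain ⟨hi, hj, x, hx, hxV⟩ := hz
      have hxs : x ∈ C e (φ z) ∩ C f (φ z) := ⟨h1 hx.1, h2 hx.2⟩
      exact ⟨⟨H.node_mem e he _ hs ⟨x, hxs.1⟩, H.node_mem f hf _ hs ⟨x, hxs.2⟩⟩,
        (hZ e he f hf hef _ hs x hxs hxV).1⟩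

end ArcSystem

/-! ### The upper bound: drawing the copies of the edges -/

namespace Graph

variable {α β : Type*} {G G' : Graph α β}

lemma Drawing.arcSystem (D : G.Drawing) (hV : G.vertexSet.Finite) (hE : G.edgeSet.Finite) :
    ArcSystem G.edgeSet (D.point '' G.vertexSet) D.curve where
  finite_edges := hE
  finite_vertices := hV.image _
  first_mem e he := by
    obtain ⟨x, y, hxy, h0, -⟩ := D.curve_ends e he
    exact ⟨x, hxy.left_mem, h0.symm⟩
  last_mem e he := by
    obtain ⟨x, y, hxy, -, h1⟩ := D.curve_ends e he
    exact ⟨y, hxy.right_mem, h1.symm⟩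
  ends_ne e he h := zero_ne_one (D.curve_injective e he h)
  eq_of_mem := by
    rintro e he _ ⟨v, hv, rfl⟩ hvr
    obtain ⟨x, y, hxy, h0, h1⟩ := D.curve_ends e he
    rw [h0, h1]
    rcases (D.inc_of_point_mem e he v hv hvr).eq_or_eq_of_isLink hxy with rfl | rfl
    · exact Or.inl rfl
    · exact Or.inr rfl
  finite_inter := D.finite_inter
  no_three := D.no_three

/-- A graph whose edges are copies of the edges of `G`, at most `k` of each, can be drawn along a
drawing of `G` with at most `k ^ 2` times as many crossings. -/
theorem Drawing.exists_copies [LinearOrder β] (D : G.Drawing) (hV : G.vertexSet.Finite)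
    (hE : G.edgeSet.Finite) (hV' : G'.vertexSet = G.vertexSet) (hE' : G'.edgeSet.Finite)
    (k : ℕ) (π : β → β) (c : β → ℕ) (hπ : ∀ e ∈ G'.edgeSet, π e ∈ G.edgeSet)
    (hlink : ∀ e ∈ G'.edgeSet, ∀ x y, G.IsLink (π e) x y → G'.IsLink e x y)
    (hck : ∀ e ∈ G'.edgeSet, c e < k)
    (hc : ∀ e ∈ G'.edgeSet, ∀ f ∈ G'.edgeSet, π e = π f → c e = c f → e = f) :
    ∃ D' : G'.Drawing, D'.crossings.encard ≤ (k : ℕ∞) ^ 2 * D.crossings.encard := by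
  obtain ⟨P, hP, hends, hφ⟩ := (D.arcSystem hV hE).exists_polygonalSystem
  obtain ⟨Q, hsimple, hQends, hQV, hsame, hdiff, hthree⟩ :=
    hP.exists_copies (hV.image _) hE' π (fun e => (c e : ℝ)) hπ
      (fun e he f hf hef hpi h => hef (hc e he f hf hpi (by exact_mod_cast h)))
  have hrange : ∀ e ∈ G'.edgeSet, Set.range (Q e).curve = (Q e).carrier := fun e he =>
    (hsimple e he).range_curve
  have hQ0 : ∀ e ∈ G'.edgeSet, ∃ x y, G.IsLink (π e) x y ∧
      (P (π e)).pt 0 = D.point x ∧ (P (π e)).pt (P (π e)).len = D.point y := by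
    intro e he
    obtain ⟨x, y, hxy, h0, h1⟩ := D.curve_ends (π e) (hπ e he)
    exact ⟨x, y, hxy, (hends _ (hπ e he)).1.trans h0, (hends _ (hπ e he)).2.trans h1⟩
  let D' : G'.Drawing :=
    { point := D.point
      curve := fun e => (Q e).curve
      point_injOn := hV' ▸ D.point_injOn
      curve_injective := fun e he => (hsimple e he).curve_injective
      curve_ends := by
        intro e he
        obtain ⟨x, y, hxy, h0, h1⟩ := hQ0 e he
        refine ⟨x, y, hlink e he x y hxy, ?_, ?_⟩
        · rw [Polyline.curve_zero, (hQends e he).2.1, h0]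
        · rw [Polyline.curve_one, (hQends e he).2.2, h1]
      inc_of_point_mem := by
        intro e he v hv hvr
        rw [hV'] at hv
        rw [hrange e he] at hvr
        obtain ⟨x, y, hxy, h0, h1⟩ := hQ0 e he
        rcases hQV e he _ ⟨v, hv, rfl⟩ hvr with h | h
        · rw [h0] at h
          rw [D.point_injOn hv hxy.left_mem h]
          exact (hlink e he x y hxy).inc_left
        · rw [h1] at h
          rw [D.point_injOn hv hxy.right_mem h]
          exact (hlink e he x y hxy).inc_right
      no_three := by
        intro e he f hf g hg hef heg hfg
        rw [hrange e he, hrange f hf, hrange g hg, hV']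
        by_cases h1 : π e = π f
        · exact Set.inter_subset_left.trans (hsame e he f hf hef h1)
        by_cases h2 : π e = π g
        · exact fun x hx => hsame e he g hg heg h2 ⟨hx.1.1, hx.2⟩
        by_cases h3 : π f = π g
        · exact fun x hx => hsame f hf g hg hfg h3 ⟨hx.1.2, hx.2⟩
        exact hthree e he f hf g hg h1 h2 h3
      finite_inter := by
        intro e he f hf hef
        rw [hrange e he, hrange f hf]
        by_cases h1 : π e = π f
        · exact (hV.image _).subset (hsame e he f hf hef h1)
        have hfin : (⋃ i ∈ Set.Iio (Q e).len, ⋃ j ∈ Set.Iio (Q f).len,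
            {x ∈ (Q e).side i ∩ (Q f).side j | x ∉ D.point '' G.vertexSet}).Finite := by
          refine (Set.finite_Iio _).biUnion fun i hi => (Set.finite_Iio _).biUnion fun j hj => ?_
          refine Set.Subsingleton.finite fun x hx y hy => ?_
          exact ((hdiff e he f hf h1 i hi j hj x hx.1).resolve_left hx.2).2 hx.1 hy.1
        refine ((hV.image D.point).union hfin).subset ?_
        rintro x ⟨⟨i, hi, hx⟩, ⟨j, hj, hx'⟩⟩
        by_cases hxV : x ∈ D.point '' G.vertexSet
        · exact Or.inl hxV
        · exact Or.inr (Set.mem_biUnion hi (Set.mem_biUnion hj ⟨⟨hx, hx'⟩, hxV⟩)) }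
  refine ⟨D', ?_⟩
  have hφ' : ∀ e f, ∃ φ : ℕ × ℕ → Plane, e ∈ G.edgeSet → f ∈ G.edgeSet → e ≠ f →
      Set.InjOn φ (crossingSides (D.point '' G.vertexSet) (P e) (P f)) ∧
      Set.MapsTo φ (crossingSides (D.point '' G.vertexSet) (P e) (P f))
        ((Set.range (D.curve e) ∩ Set.range (D.curve f)) \ D.point '' G.vertexSet) := by
    intro e f
    by_cases h : e ∈ G.edgeSet ∧ f ∈ G.edgeSet ∧ e ≠ f
    · obtain ⟨φ, h'⟩ := hφ e h.1 f h.2.1 h.2.2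
      exact ⟨φ, fun _ _ _ => h'⟩
    · exact ⟨0, fun h1 h2 h3 => absurd ⟨h1, h2, h3⟩ h⟩
  choose φ hφ using hφ'
  -- Each crossing of `D'` gets an ordered pair of edges, with `π` increasing, and the sides that
  -- contain it. The order makes the labels below well determined by the unordered pair.
  have hdata : ∀ z : Sym2 β × Plane, ∃ d : (β × β) × (ℕ × ℕ), z ∈ D'.crossings →
      d.1.1 ∈ G'.edgeSet ∧ d.1.2 ∈ G'.edgeSet ∧ π d.1.1 < π d.1.2 ∧ z.1 = s(d.1.1, d.1.2) ∧
      d.2 ∈ crossingSides (D.point '' G.vertexSet) (P (π d.1.1)) (P (π d.1.2)) ∧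
      z.2 ∈ (Q d.1.1).side d.2.1 ∩ (Q d.1.2).side d.2.2 ∧
      ((Q d.1.1).side d.2.1 ∩ (Q d.1.2).side d.2.2).Subsingleton := by
    rintro ⟨p, x⟩
    by_cases hz : (p, x) ∈ D'.crossings
    · have key : ∃ e ∈ G'.edgeSet, ∃ f ∈ G'.edgeSet, π e < π f ∧ p = s(e, f) ∧
          x ∈ (Q e).carrier ∧ x ∈ (Q f).carrier ∧ x ∉ D.point '' G.vertexSet := by
        obtain ⟨e, he, f, hf, hef, hp, hxe, hxf, hxV⟩ := hz
        change x ∈ Set.range (Q e).curve at hxe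
        change x ∈ Set.range (Q f).curve at hxf
        change x ∉ D.point '' G'.vertexSet at hxV
        rw [hrange e he] at hxe
        rw [hrange f hf] at hxf
        rw [hV'] at hxV
        rcases lt_trichotomy (π e) (π f) with h | h | h
        · exact ⟨e, he, f, hf, h, hp, hxe, hxf, hxV⟩
        · exact absurd (hsame e he f hf hef h ⟨hxe, hxf⟩) hxV
        · exact ⟨f, hf, e, he, h, hp.trans Sym2.eq_swap, hxf, hxe, hxV⟩
      obtain ⟨e, he, f, hf, hlt, hp, ⟨i, hi, hxi⟩, ⟨j, hj, hxj⟩, hxV⟩ := key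
      obtain ⟨h1, h2⟩ := (hdiff e he f hf hlt.ne i hi j hj x ⟨hxi, hxj⟩).resolve_left hxV
      exact ⟨((e, f), (i, j)), fun _ => ⟨he, hf, hlt, hp, h1, ⟨hxi, hxj⟩, h2⟩⟩
    · by_cases hne : Nonempty β
      · obtain ⟨b⟩ := hne
        exact ⟨((b, b), 0), fun h => absurd h hz⟩
      · exact absurd ⟨p.out.1⟩ hne
  choose d hd using hdata
  -- A crossing is encoded by a crossing of `D` and the numbers of the two copies; this accounts for
  -- the factor `k ^ 2`.
  have hmaps : Set.MapsTo (fun z => ((s(π (d z).1.1, π (d z).1.2),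
      φ (π (d z).1.1) (π (d z).1.2) (d z).2), (c (d z).1.1, c (d z).1.2))) D'.crossings
      (D.crossings ×ˢ (Set.Iio k ×ˢ Set.Iio k)) := by
    intro z hz
    obtain ⟨he, hf, hlt, -, hcr, -, -⟩ := hd z hz
    have h1 := (hφ _ _ (hπ _ he) (hπ _ hf) hlt.ne).2 hcr
    exact ⟨⟨_, hπ _ he, _, hπ _ hf, hlt.ne, rfl, h1.1.1, h1.1.2, h1.2⟩, hck _ he, hck _ hf⟩
  have hinj : Set.InjOn (fun z => ((s(π (d z).1.1, π (d z).1.2),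
      φ (π (d z).1.1) (π (d z).1.2) (d z).2), (c (d z).1.1, c (d z).1.2))) D'.crossings := by
    intro z hz z' hz' heq
    obtain ⟨he, hf, hlt, hz1, hcr, hx, hsub⟩ := hd z hz
    obtain ⟨he', hf', hlt', hz1', hcr', hx', -⟩ := hd z' hz'
    simp only [Prod.mk.injEq, Sym2.eq_iff] at heq
    obtain ⟨⟨h1, h2⟩, h3, h4⟩ := heq
    have h1 : π (d z).1.1 = π (d z').1.1 ∧ π (d z).1.2 = π (d z').1.2 := by
      rcases h1 with h | ⟨h, h'⟩
      · exact h
      · rw [h, h'] at hlt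
        exact absurd hlt hlt'.asymm
    have e1 := hc _ he _ he' h1.1 h3
    have e2 := hc _ hf _ hf' h1.2 h4
    rw [← e1, ← e2] at hcr' hx' h2
    have e3 := (hφ _ _ (hπ _ he) (hπ _ hf) hlt.ne).1 hcr hcr' h2
    rw [← e3] at hx'
    exact Prod.ext (by rw [hz1, hz1', e1, e2]) (hsub hx hx')
  refine (Set.encard_le_encard_of_injOn hmaps hinj).trans ?_
  have hIio : (Set.Iio k).encard = k := by
    rw [← Finset.coe_Iio, Set.encard_coe_eq_coe_finsetCard, Nat.card_Iio]
  rw [Set.encard_prod, Set.encard_prod, hIio, ← sq, mul_comm]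

end Graph

/-- A finite value rules out empty families, and minima in `ℕ∞` over nonempty families are attained.
-/
lemma exists_crossings_encard_eq {n m : ℕ} (h : crSimple n m ≠ ⊤) :
    ∃ G : Graph ℕ ℕ, G.vertexSet.encard = n ∧ G.edgeSet.encard = m ∧ G.Simple ∧
      ∃ D : G.Drawing, D.crossings.encard = crSimple n m := by
  have h1 : Nonempty {G : Graph ℕ ℕ //
      G.vertexSet.encard = n ∧ G.edgeSet.encard = m ∧ G.Simple} := by
    by_contra hne
    rw [not_nonempty_iff] at hne
    exact h (iInf_of_empty _)
  obtain ⟨G, hG⟩ := ENat.exists_eq_iInf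
    fun G : {G : Graph ℕ ℕ // G.vertexSet.encard = n ∧ G.edgeSet.encard = m ∧ G.Simple} =>
      G.1.crossingNumber
  have hG : G.1.crossingNumber = crSimple n m := hG
  have h2 : Nonempty G.1.Drawing := by
    by_contra hne
    rw [not_nonempty_iff] at hne
    exact h (hG ▸ iInf_of_empty _)
  obtain ⟨D, hD⟩ := ENat.exists_eq_iInf fun D : G.1.Drawing => D.crossings.encard
  exact ⟨G.1, G.2.1, G.2.2.1, G.2.2.2, D, hD.trans hG⟩

lemma le_mul_ceil_div (m k : ℕ) (hk : 1 ≤ k) : m ≤ k * ⌈(m : ℝ) / k⌉₊ := by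
  have hk' : (0 : ℝ) < k := by exact_mod_cast hk
  have := Nat.le_ceil ((m : ℝ) / k)
  rw [div_le_iff₀ hk'] at this
  rw [mul_comm]
  exact_mod_cast this

/-- The graph with edges in `F`, in which the edge with number `Nat.pair e i` is a copy of the
edge `e` of `G`. -/
def Graph.copies {α : Type*} (G : Graph α ℕ) (F : Set ℕ)
    (hF : ∀ a ∈ F, a.unpair.1 ∈ G.edgeSet) : Graph α ℕ where
  vertexSet := G.vertexSet
  edgeSet := F
  IsLink a x y := a ∈ F ∧ G.IsLink a.unpair.1 x y
  isLink_symm _ _ := ⟨fun _ _ h => ⟨h.1, h.2.symm⟩⟩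
  eq_or_eq_of_isLink_of_isLink _ _ _ _ _ h h' := h.2.left_eq_or_eq h'.2
  edge_mem_iff_exists_isLink a := by
    refine ⟨fun h => ?_, fun ⟨x, y, h⟩ => h.1⟩
    obtain ⟨x, y, hxy⟩ := G.exists_isLink_of_mem_edgeSet (hF a h)
    exact ⟨x, y, h, hxy⟩
  left_mem_of_isLink _ _ _ h := h.2.left_mem

theorem crMulti_le (n m k : ℕ) (hk : 1 ≤ k) :
    crMulti n m k ≤ (k : ℕ∞) ^ 2 * crSimple n ⌈(m : ℝ) / k⌉₊ := by
  by_cases htop : crSimple n ⌈(m : ℝ) / k⌉₊ = ⊤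
  · rw [htop, ENat.mul_top (by positivity)]
    exact le_top
  obtain ⟨G, hV, hE, hsimple, D, hD⟩ := exists_crossings_encard_eq htop
  have hIio : (Set.Iio k).encard = k := by
    rw [← Finset.coe_Iio, Set.encard_coe_eq_coe_finsetCard, Nat.card_Iio]
  -- Any `m` of the `k * ⌈m / k⌉` available copies will do.
  obtain ⟨F, hFsub, hF⟩ := Set.exists_subset_encard_eq
    (s := (fun z : ℕ × ℕ => Nat.pair z.1 z.2) '' (G.edgeSet ×ˢ Set.Iio k)) (k := m) (by
      rw [Set.InjOn.encard_image fun z _ z' _ h => ?_, Set.encard_prod, hE, hIio]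
      · rw [mul_comm]
        exact_mod_cast le_mul_ceil_div m k hk
      · exact Prod.ext (Nat.pair_eq_pair.1 h).1 (Nat.pair_eq_pair.1 h).2)
  have hF1 : ∀ a ∈ F, a.unpair.1 ∈ G.edgeSet ∧ a.unpair.2 < k := by
    intro a ha
    obtain ⟨z, hz, rfl⟩ := hFsub ha
    simpa using hz
  have hFinj : ∀ a b : ℕ, a.unpair.1 = b.unpair.1 → a.unpair.2 = b.unpair.2 → a = b :=
    fun a b h1 h2 => by rw [← Nat.pair_unpair a, ← Nat.pair_unpair b, h1, h2]
  set G' := G.copies F fun a ha => (hF1 a ha).1 with hG'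
  have hVfin : G.vertexSet.Finite := Set.finite_of_encard_eq_coe hV
  have hEfin : G.edgeSet.Finite := Set.finite_of_encard_eq_coe hE
  have hFfin : F.Finite := Set.finite_of_encard_eq_coe hF
  obtain ⟨D', hD'⟩ := D.exists_copies (G' := G') hVfin hEfin rfl hFfin k
    (fun a => a.unpair.1) (fun a => a.unpair.2) (fun a ha => (hF1 a ha).1)
    (fun a ha x y h => ⟨ha, h⟩) (fun a ha => (hF1 a ha).2) (fun a _ b _ => hFinj a b)
  have hmult : G'.MultiplicityLE k := by
    intro x y
    rw [← hIio]
    refine Set.encard_le_encard_of_injOn (f := fun a => a.unpair.2) (fun a ha => (hF1 a ha.1).2)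
      fun a ha b hb h => hFinj a b (ha.2.eq hb.2) h
  have hloop : G'.Loopless := ⟨fun a x h => hsimple.not_isLoopAt _ _ h.2⟩
  rw [← hD]
  refine le_trans ?_ hD'
  refine le_trans (iInf_le _ ⟨G', hV, hF, hloop, hmult⟩) ?_
  exact iInf_le _ D'

/-! ### Rounding of quadratic forms -/

section Rounding

variable {β ι κ : Type*} [DecidableEq β] [DecidableEq κ]

/-- Weights between `0` and `1` that add up to at most `1` in each class. -/
structure IsClassWeight (E : Finset β) (cl : β → κ) (p : β → ℝ) : Prop where
  nonneg : ∀ e ∈ E, 0 ≤ p e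
  le_one : ∀ e ∈ E, p e ≤ 1
  sum_le : ∀ i, ∑ f ∈ E with cl f = i, p f ≤ 1

/-- The elements with a weight other than `0` and `1`. -/
noncomputable def fractional (E : Finset β) (p : β → ℝ) : Finset β :=
  {e ∈ E | 0 < p e ∧ p e < 1}

/-- Changing the weights by `t` times this vector moves the weight `t` from `f` to `e`. -/
def shift (e f : β) : β → ℝ := Pi.single e 1 - Pi.single f 1

lemma sum_shift (S : Finset β) (e f : β) :
    ∑ x ∈ S, shift e f x = (if e ∈ S then 1 else 0) - (if f ∈ S then 1 else 0) := by
  simp [shift, Finset.sum_sub_distrib, Pi.single_apply]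

lemma shift_mul_shift_nonpos {e f x y : β} (hxy : x ≠ y) :
    shift e f x * shift e f y ≤ 0 := by
  simp only [shift, Pi.sub_apply, Pi.single_apply]
  split_ifs <;> simp_all

variable {E : Finset β} {cl : β → κ} {p : β → ℝ}

lemma IsClassWeight.add_le (hp : IsClassWeight E cl p) {e f : β} (he : e ∈ E) (hf : f ∈ E)
    (hef : e ≠ f) (hcl : cl e = cl f) : p e + p f ≤ 1 := by
  refine le_trans ?_ (hp.sum_le (cl e))
  rw [← Finset.sum_pair hef]
  refine Finset.sum_le_sum_of_subset_of_nonneg ?_ fun x hx _ =>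
    hp.nonneg x (Finset.mem_filter.1 hx).1
  intro x hx
  rcases Finset.mem_insert.1 hx with rfl | hx
  · simp [he]
  · rw [Finset.mem_singleton.1 hx]; simp [hf, hcl]

/-- The step `t` is the largest that keeps `p e ≤ 1` and `p f ≥ 0`, so one of the two weights stops
being fractional. Within one class the sum does not change. In the other case `e` carries all the
weight of its class: another positive weight there would be less than 1, thus fractional, against
injectivity. -/
lemma IsClassWeight.exists_shift (hp : IsClassWeight E cl p) {e f : β}
    (he : e ∈ fractional E p) (hf : f ∈ fractional E p) (hef : e ≠ f)
    (hcl : cl e = cl f ∨ Set.InjOn cl (fractional E p : Set β)) :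
    ∃ t : ℝ, 0 < t ∧ IsClassWeight E cl (p + t • shift e f) ∧
      (fractional E (p + t • shift e f)).card < (fractional E p).card := by
  obtain ⟨heE, he0, he1⟩ := Finset.mem_filter.1 he
  obtain ⟨hfE, hf0, hf1⟩ := Finset.mem_filter.1 hf
  set t := min (1 - p e) (p f) with ht
  have ht0 : 0 < t := lt_min (by linarith) hf0
  have ht1 : t ≤ 1 - p e := min_le_left _ _
  have ht2 : t ≤ p f := min_le_right _ _
  have hpe : (p + t • shift e f) e = p e + t := by simp [shift, hef]
  have hpf : (p + t • shift e f) f = p f - t := by simp [shift, hef.symm]; ring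
  have hpx : ∀ x, x ≠ e → x ≠ f → (p + t • shift e f) x = p x := fun x h1 h2 => by
    simp [shift, h1, h2]
  refine ⟨t, ht0, ⟨fun x hx => ?_, fun x hx => ?_, fun i => ?_⟩, ?_⟩
  · by_cases h1 : x = e
    · rw [h1, hpe]; linarith
    by_cases h2 : x = f
    · rw [h2, hpf]; linarith
    rw [hpx x h1 h2]; exact hp.nonneg x hx
  · by_cases h1 : x = e
    · rw [h1, hpe]; linarith
    by_cases h2 : x = f
    · rw [h2, hpf]; linarith
    rw [hpx x h1 h2]; exact hp.le_one x hx
  · have hsum : ∑ x ∈ E with cl x = i, (p + t • shift e f) x =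
        ∑ x ∈ E with cl x = i, p x +
          t * ((if cl e = i then 1 else 0) - (if cl f = i then 1 else 0)) := by
      simp only [Pi.add_apply, Pi.smul_apply, smul_eq_mul, Finset.sum_add_distrib,
        ← Finset.mul_sum, sum_shift, Finset.mem_filter, heE, hfE, true_and]
    have hle := hp.sum_le i
    rw [hsum]
    by_cases h1 : cl e = i
    · by_cases h2 : cl f = i
      · simpa [h1, h2] using hle
      · have hinj := hcl.resolve_left fun h => h2 (h ▸ h1)
        have : ∑ x ∈ E with cl x = i, p x = p e := by
          refine Finset.sum_eq_single_of_mem e (by simp [heE, h1]) fun x hx hxe => ?_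
          obtain ⟨hxE, hxi⟩ := Finset.mem_filter.1 hx
          have hadd := hp.add_le hxE heE hxe (hxi.trans h1.symm)
          by_contra hx0
          have hxpos := lt_of_le_of_ne (hp.nonneg x hxE) (Ne.symm hx0)
          exact hxe (hinj (Finset.mem_coe.2 (Finset.mem_filter.2
            ⟨hxE, hxpos, by linarith⟩)) (Finset.mem_coe.2 he) (hxi.trans h1.symm))
        rw [this]
        simp only [h1, h2, if_true, if_false]
        linarith
    · by_cases h2 : cl f = i
      · simp only [h1, h2, if_true, if_false]; linarith
      · simpa [h1, h2] using hle
  · refine Finset.card_lt_card ((Finset.ssubset_iff_of_subset fun x hx => ?_).2 ?_)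
    · obtain ⟨hxE, h0, h1⟩ := Finset.mem_filter.1 hx
      by_cases h1 : x = e
      · rwa [h1]
      by_cases h2 : x = f
      · rwa [h2]
      rw [hpx x h1 h2] at *
      exact Finset.mem_filter.2 ⟨hxE, h0, by assumption⟩
    · rcases min_choice (1 - p e) (p f) with h | h
      · refine ⟨e, he, fun h' => ?_⟩
        have := (Finset.mem_filter.1 h').2.2
        rw [hpe, ht, h] at this
        linarith
      · refine ⟨f, hf, fun h' => ?_⟩
        have := (Finset.mem_filter.1 h').2.1
        rw [hpf, ht, h] at this
        linarith

/-- The sum over the pairs `(a c, b c)` of the products of the weights. -/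
def pairSum (C : Finset ι) (a b : ι → β) (p : β → ℝ) : ℝ := ∑ c ∈ C, p (a c) * p (b c)

variable {C : Finset ι} {a b : ι → β}

/-- The coefficient of `t ^ 2` is not positive: `shift e f` has at most one positive and one
negative entry, and `a c ≠ b c` excludes squares. -/
lemma pairSum_add_shift_le (hab : ∀ c ∈ C, a c ≠ b c) (e f : β) (t : ℝ) :
    pairSum C a b (p + t • shift e f) ≤ pairSum C a b p +
      t * ∑ c ∈ C, (shift e f (a c) * p (b c) + p (a c) * shift e f (b c)) := by
  rw [pairSum, pairSum, Finset.mul_sum, ← Finset.sum_add_distrib]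
  refine Finset.sum_le_sum fun c hc => ?_
  have := mul_nonneg_of_nonpos_of_nonpos (shift_mul_shift_nonpos (e := e) (f := f) (hab c hc)) (neg_nonpos.2
    (sq_nonneg t))
  simp only [Pi.add_apply, Pi.smul_apply, smul_eq_mul]
  nlinarith

lemma shift_swap (e f : β) : shift f e = -shift e f := by simp [shift]

/-- Two fractional elements of one class are preferred. The sign of the linear coefficient `A`
decides in which direction the weight moves. -/
lemma IsClassWeight.exists_shift_le (hab : ∀ c ∈ C, a c ≠ b c) (hp : IsClassWeight E cl p)
    (hcard : 1 < (fractional E p).card) :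
    ∃ p', IsClassWeight E cl p' ∧ (fractional E p').card < (fractional E p).card ∧
      ∑ e ∈ E, p' e = ∑ e ∈ E, p e ∧ pairSum C a b p' ≤ pairSum C a b p := by
  obtain ⟨e, he, f, hf, hef, hcl⟩ : ∃ e ∈ fractional E p, ∃ f ∈ fractional E p, e ≠ f ∧
      (cl e = cl f ∨ Set.InjOn cl (fractional E p : Set β)) := by
    by_cases hinj : Set.InjOn cl (fractional E p : Set β)
    · obtain ⟨e, he, f, hf, hef⟩ := Finset.one_lt_card.1 hcard
      exact ⟨e, he, f, hf, hef, Or.inr hinj⟩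
    · simp only [Set.InjOn, not_forall] at hinj
      obtain ⟨e, he, f, hf, hcl, hef⟩ := hinj
      exact ⟨e, he, f, hf, hef, Or.inl hcl⟩
  have hsum : ∀ t : ℝ, ∑ x ∈ E, (p + t • shift e f) x = ∑ x ∈ E, p x := fun t => by
    simp only [Pi.add_apply, Pi.smul_apply, smul_eq_mul, Finset.sum_add_distrib,
      ← Finset.mul_sum, sum_shift, (Finset.mem_filter.1 he).1, (Finset.mem_filter.1 hf).1]
    simp
  have hle := fun t : ℝ => pairSum_add_shift_le (p := p) hab e f t
  set A := ∑ c ∈ C, (shift e f (a c) * p (b c) + p (a c) * shift e f (b c))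
  rcases le_total A 0 with hA | hA
  · obtain ⟨t, ht, h1, h2⟩ := hp.exists_shift he hf hef hcl
    exact ⟨_, h1, h2, hsum t, (hle t).trans (by nlinarith)⟩
  · obtain ⟨t, ht, h1, h2⟩ := hp.exists_shift hf he hef.symm (hcl.imp Eq.symm id)
    rw [shift_swap, smul_neg, ← neg_smul] at h1 h2
    exact ⟨_, h1, h2, hsum (-t), (hle (-t)).trans (by nlinarith)⟩

lemma IsClassWeight.exists_fractional_card_le_one (hab : ∀ c ∈ C, a c ≠ b c)
    (hp : IsClassWeight E cl p) :
    ∃ p', IsClassWeight E cl p' ∧ (fractional E p').card ≤ 1 ∧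
      ∑ e ∈ E, p' e = ∑ e ∈ E, p e ∧ pairSum C a b p' ≤ pairSum C a b p := by
  induction hn : (fractional E p).card using Nat.strong_induction_on generalizing p with
  | _ n ih =>
    rcases Nat.lt_or_ge 1 n with h | h
    · obtain ⟨q, hq, h1, h2, h3⟩ := hp.exists_shift_le hab (hn.symm ▸ h)
      obtain ⟨p', hp', h1', h2', h3'⟩ := ih _ (hn ▸ h1) hq rfl
      exact ⟨p', hp', h1', h2'.trans h2, h3'.trans h3⟩
    · exact ⟨p, hp, hn.le.trans h, rfl, le_rfl⟩

lemma IsClassWeight.exists_of_card_le_one (hab : ∀ c ∈ C, a c ≠ b c ∧ a c ∈ E ∧ b c ∈ E)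
    (hp : IsClassWeight E cl p) (hcard : (fractional E p).card ≤ 1) :
    ∃ T ⊆ E, ∃ T' ⊆ E, Set.InjOn cl (T : Set β) ∧ Set.InjOn cl (T' : Set β) ∧
      T.card = ⌊∑ e ∈ E, p e⌋₊ ∧ T'.card = ⌈∑ e ∈ E, p e⌉₊ ∧
      (1 - Int.fract (∑ e ∈ E, p e)) * ({c ∈ C | a c ∈ T ∧ b c ∈ T} : Finset ι).card +
        Int.fract (∑ e ∈ E, p e) * ({c ∈ C | a c ∈ T' ∧ b c ∈ T'} : Finset ι).card =
        pairSum C a b p := by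
  set T : Finset β := {e ∈ E | p e = 1} with hT
  have hTE : T ⊆ E := Finset.filter_subset _ _
  -- Among two elements of `S`, at least one has weight 1, and the other has positive weight; in one
  -- class the sum would exceed 1.
  have hTinj : ∀ S ⊆ E, (∀ e ∈ S, 0 < p e) → (∀ e ∈ S, e ∉ T → S ⊆ insert e T) →
      Set.InjOn cl (S : Set β) := by
    intro S hS hpos hST e he f hf hcl
    by_contra hef
    have hadd := hp.add_le (hS he) (hS hf) hef hcl
    by_cases heT : e ∈ T
    · have := (Finset.mem_filter.1 heT).2
      have := hpos f hf
      linarith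
    · rcases Finset.mem_insert.1 (hST e he heT hf) with h | h
      · exact hef h.symm
      · have := (Finset.mem_filter.1 h).2
        have := hpos e he
        linarith
  have hT1 : Set.InjOn cl (T : Set β) := hTinj T hTE
    (fun e he => by rw [(Finset.mem_filter.1 he).2]; norm_num) (fun e he h => absurd he h)
  have hzero : ∀ e ∈ E, e ∉ T → e ∉ fractional E p → p e = 0 := by
    intro e he h1 h2
    by_contra h0
    have h3 := lt_of_le_of_ne (hp.nonneg e he) (Ne.symm h0)
    have h4 := lt_of_le_of_ne (hp.le_one e he) fun h => h1 (Finset.mem_filter.2 ⟨he, h⟩)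
    exact h2 (Finset.mem_filter.2 ⟨he, h3, h4⟩)
  have hone : ∀ e ∈ T, p e = 1 := fun e he => (Finset.mem_filter.1 he).2
  have hsumT : ∑ e ∈ T, p e = T.card := by
    rw [Finset.sum_congr rfl hone]; simp
  rcases (fractional E p).eq_empty_or_nonempty with hemp | ⟨e₀, he₀⟩
  · have hsum : ∑ e ∈ E, p e = T.card := by
      rw [← hsumT]
      exact (Finset.sum_subset hTE fun e he h => hzero e he h (by simp [hemp])).symm
    rw [hsum]
    refine ⟨T, hTE, T, hTE, hT1, hT1, by simp, by simp, ?_⟩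
    rw [Int.fract_natCast, sub_zero, one_mul, zero_mul, add_zero, pairSum,
      Finset.natCast_card_filter]
    refine Finset.sum_congr rfl fun c hc => ?_
    obtain ⟨-, h1, h2⟩ := hab c hc
    have hz := fun e he h => hzero e he h (by simp [hemp])
    by_cases h3 : a c ∈ T
    · by_cases h4 : b c ∈ T
      · simp [h3, h4, hone _ h3, hone _ h4]
      · simp [h4, hz _ h2 h4]
    · simp [h3, hz _ h1 h3]
  · have huniq : ∀ e ∈ fractional E p, e = e₀ := fun e he =>
      Finset.card_le_one.1 hcard e he e₀ he₀
    obtain ⟨he₀E, hpos, hlt⟩ := Finset.mem_filter.1 he₀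
    have he₀T : e₀ ∉ T := fun h => hlt.ne (hone _ h)
    have hT'E : insert e₀ T ⊆ E := Finset.insert_subset he₀E hTE
    have hz : ∀ e ∈ E, e ≠ e₀ → e ∉ T → p e = 0 := fun e he h1 h2 =>
      hzero e he h2 fun h => h1 (huniq e h)
    have hsum : ∑ e ∈ E, p e = T.card + p e₀ := by
      rw [← hsumT, add_comm, ← Finset.sum_insert he₀T]
      refine (Finset.sum_subset hT'E fun e he h => ?_).symm
      rw [Finset.mem_insert, not_or] at h
      exact hz e he h.1 h.2
    rw [hsum]
    refine ⟨T, hTE, insert e₀ T, hT'E, hT1, hTinj _ hT'E ?_ ?_, ?_, ?_, ?_⟩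
    · intro e he
      rcases Finset.mem_insert.1 he with rfl | he
      · exact hpos
      · rw [hone e he]; norm_num
    · intro e he heT
      rcases Finset.mem_insert.1 he with rfl | he
      · exact subset_rfl
      · exact absurd he heT
    · symm
      rw [Nat.floor_eq_iff (by positivity)]
      constructor <;> linarith
    · symm
      rw [Finset.card_insert_of_notMem he₀T, Nat.ceil_eq_iff (by omega), Nat.add_sub_cancel]
      push_cast
      constructor <;> linarith
    · have hfr : Int.fract ((T.card : ℝ) + p e₀) = p e₀ := by
        rw [Int.fract_natCast_add, Int.fract_eq_self.2 ⟨hpos.le, hlt⟩]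
      rw [hfr, pairSum, Finset.natCast_card_filter, Finset.natCast_card_filter, Finset.mul_sum,
        Finset.mul_sum, ← Finset.sum_add_distrib]
      -- A pair contributes 1 if it lies in `T`, `p e₀` if it consists of `e₀` and an element of
      -- `T`, and 0 otherwise; it is never `e₀` twice.
      refine Finset.sum_congr rfl fun c hc => ?_
      obtain ⟨hne, h1, h2⟩ := hab c hc
      by_cases ha : a c = e₀
      · have hb : b c ≠ e₀ := fun h => hne (ha.trans h.symm)
        by_cases h4 : b c ∈ T
        · simp [ha, he₀T, h4, hone _ h4]
        · simp [ha, he₀T, h4, hb, hz _ h2 hb h4]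
      · by_cases hb : b c = e₀
        · by_cases h4 : a c ∈ T
          · simp [hb, he₀T, h4, hone _ h4]
          · simp [hb, he₀T, h4, ha, hz _ h1 ha h4]
        · by_cases h3 : a c ∈ T
          · by_cases h4 : b c ∈ T
            · simp [h3, h4, hone _ h3, hone _ h4]
            · simp [h4, hb, hz _ h2 hb h4]
          · simp [h3, ha, hz _ h1 ha h3]

theorem IsClassWeight.exists_rounding (hab : ∀ c ∈ C, a c ≠ b c ∧ a c ∈ E ∧ b c ∈ E)
    (hp : IsClassWeight E cl p) :
    ∃ T ⊆ E, ∃ T' ⊆ E, Set.InjOn cl (T : Set β) ∧ Set.InjOn cl (T' : Set β) ∧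
      T.card = ⌊∑ e ∈ E, p e⌋₊ ∧ T'.card = ⌈∑ e ∈ E, p e⌉₊ ∧
      (1 - Int.fract (∑ e ∈ E, p e)) * ({c ∈ C | a c ∈ T ∧ b c ∈ T} : Finset ι).card +
        Int.fract (∑ e ∈ E, p e) * ({c ∈ C | a c ∈ T' ∧ b c ∈ T'} : Finset ι).card ≤
        pairSum C a b p := by
  obtain ⟨p', hp', h1, h2, h3⟩ := hp.exists_fractional_card_le_one fun c hc => (hab c hc).1
  obtain ⟨T, hT, T', hT', h4, h5, h6, h7, h8⟩ := hp'.exists_of_card_le_one hab h1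
  rw [h2] at h6 h7 h8
  exact ⟨T, hT, T', hT', h4, h5, h6, h7, h8.trans_le h3⟩

end Rounding

/-! ### The lower bound: simple subgraphs of a drawn multigraph -/

namespace Graph

variable {α β : Type*} {G : Graph α β}

/-- The restriction of a drawing to a set of edges. -/
def Drawing.restrict (D : G.Drawing) (F : Set β) : (G.restrict F).Drawing where
  point := D.point
  curve := D.curve
  point_injOn := D.point_injOn
  curve_injective e he := D.curve_injective e he.1
  curve_ends e he := by
    obtain ⟨x, y, hxy, h⟩ := D.curve_ends e he.1
    exact ⟨x, y, ⟨he.2, hxy⟩, h⟩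
  inc_of_point_mem e he v hv h := by
    obtain ⟨y, hy⟩ := D.inc_of_point_mem e he.1 v hv h
    exact ⟨y, he.2, hy⟩
  no_three e he f hf g hg := D.no_three e he.1 f hf.1 g hg.1
  finite_inter e he f hf := D.finite_inter e he.1 f hf.1

lemma Drawing.crossings_restrict_subset (D : G.Drawing) (F : Set β) :
    (D.restrict F).crossings ⊆ {z ∈ D.crossings | ∀ e ∈ z.1, e ∈ F} := by
  rintro z ⟨e, he, f, hf, hef, hz, h⟩
  refine ⟨⟨e, he.1, f, hf.1, hef, hz, h⟩, fun g hg => ?_⟩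
  rw [hz, Sym2.mem_iff] at hg
  rcases hg with rfl | rfl
  · exact he.2
  · exact hf.2

lemma Drawing.finite_crossings (D : G.Drawing) (hE : G.edgeSet.Finite) : D.crossings.Finite := by
  have : (⋃ e ∈ G.edgeSet, ⋃ f ∈ G.edgeSet, ⋃ _ : e ≠ f,
      ({s(e, f)} ×ˢ (Set.range (D.curve e) ∩ Set.range (D.curve f)) :
        Set (Sym2 β × Plane))).Finite :=
    hE.biUnion fun e he => hE.biUnion fun f hf => Set.finite_iUnion fun hef =>
      (Set.finite_singleton _).prod (D.finite_inter e he f hf hef)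
  refine this.subset ?_
  rintro z ⟨e, he, f, hf, hef, hz, h1, h2, -⟩
  simp only [Set.mem_iUnion]
  exact ⟨e, he, f, hf, hef, hz, h1, h2⟩

lemma Drawing.crossingNumber_le (D : G.Drawing) : G.crossingNumber ≤ D.crossings.encard :=
  iInf_le _ D

end Graph

lemma crSimple_le_encard {n m : ℕ} {G : Graph ℕ ℕ} (hV : G.vertexSet.encard = n) (D : G.Drawing)
    {T : Set ℕ} (hT : T ⊆ G.edgeSet) (hm : T.encard = m) (hsimple : (G.restrict T).Simple) :
    crSimple n m ≤ {z ∈ D.crossings | ∀ e ∈ z.1, e ∈ T}.encard := by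
  have hE : (G.restrict T).edgeSet.encard = m := by
    rw [Graph.edgeSet_restrict, Set.inter_eq_self_of_subset_right hT, hm]
  exact (iInf_le _ ⟨G.restrict T, hV, hE, hsimple⟩).trans
    ((D.restrict T).crossingNumber_le.trans (Set.encard_le_encard (D.crossings_restrict_subset T)))

lemma crSimple_mono (n : ℕ) {m m' : ℕ} (h : m ≤ m') : crSimple n m ≤ crSimple n m' := by
  by_cases htop : crSimple n m' = ⊤
  · rw [htop]; exact le_top
  obtain ⟨G, hV, hE, hsimple, D, hD⟩ := exists_crossings_encard_eq htop
  obtain ⟨T, hT, hm⟩ := Set.exists_subset_encard_eq (s := G.edgeSet) (k := m)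
    (by rw [hE]; exact_mod_cast h)
  rw [← hD]
  exact (crSimple_le_encard hV D hT hm (hsimple.anti Graph.restrict_le)).trans
    (Set.encard_le_encard (Set.sep_subset _ _))

lemma Graph.exists_ends {α β : Type*} [Nonempty α] (G : Graph α β) :
    ∃ cl : β → Sym2 α, ∀ e x y, G.IsLink e x y → cl e = s(x, y) := by
  have : ∀ e, ∃ c : Sym2 α, ∀ x y, G.IsLink e x y → c = s(x, y) := by
    intro e
    by_cases h : e ∈ G.edgeSet
    · obtain ⟨x, y, hxy⟩ := G.exists_isLink_of_mem_edgeSet h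
      exact ⟨s(x, y), fun x' y' h' => hxy.isLink_iff_sym2_eq.1 h'⟩
    · obtain ⟨a⟩ := ‹Nonempty α›
      exact ⟨s(a, a), fun x y h' => absurd h'.edge_mem h⟩
  choose cl hcl using this
  exact ⟨cl, hcl⟩

lemma Graph.simple_restrict {α β : Type*} {G : Graph α β} (hG : G.Loopless) {cl : β → Sym2 α}
    (hcl : ∀ e x y, G.IsLink e x y → cl e = s(x, y)) {T : Set β} (hT : Set.InjOn cl T) :
    (G.restrict T).Simple where
  not_isLoopAt e x h := hG.not_isLoopAt e x h.2
  eq_of_isLink e f x y he hf :=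
    hT he.1 hf.1 ((hcl e x y he.2).trans (hcl f x y hf.2).symm)

theorem exists_rounding_of_drawing {n m k : ℕ} (hk : 1 ≤ k) {G : Graph ℕ ℕ}
    (hV : G.vertexSet.encard = n) (hE : G.edgeSet.encard = m) (hloop : G.Loopless)
    (hmult : G.MultiplicityLE k) (D : G.Drawing) :
    ∃ A B : ℕ, crSimple n ⌊(m : ℝ) / k⌋₊ ≤ A ∧ crSimple n ⌈(m : ℝ) / k⌉₊ ≤ B ∧
      (k : ℝ) ^ 2 * ((1 - Int.fract ((m : ℝ) / k)) * A + Int.fract ((m : ℝ) / k) * B) ≤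
        D.crossings.ncard := by
  classical
  have hk0 : (0 : ℝ) < k := by exact_mod_cast hk
  have hEfin : G.edgeSet.Finite := Set.finite_of_encard_eq_coe hE
  have hCfin := D.finite_crossings hEfin
  set E := hEfin.toFinset with hEdef
  set C := hCfin.toFinset with hCdef
  obtain ⟨cl, hcl⟩ := G.exists_ends
  have hEcard : E.card = m := by
    rw [hEfin.encard_eq_coe_toFinset_card] at hE
    exact_mod_cast hE
  have hab : ∀ z : Sym2 ℕ × Plane, ∃ d : ℕ × ℕ, z ∈ C →
      z.1 = s(d.1, d.2) ∧ d.1 ≠ d.2 ∧ d.1 ∈ E ∧ d.2 ∈ E := by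
    intro z
    by_cases hz : z ∈ D.crossings
    · obtain ⟨e, he, f, hf, hef, hz1, -⟩ := hz
      exact ⟨(e, f), fun _ => ⟨hz1, hef, by simpa [hEdef] using he, by simpa [hEdef] using hf⟩⟩
    · exact ⟨0, fun h => absurd (by simpa [hCdef] using h) hz⟩
  choose d hd using hab
  -- Here the multiplicity enters: at most `k` parallel edges of weight `1 / k` have total weight at
  -- most 1.
  have hp : IsClassWeight E cl (fun _ => (k : ℝ)⁻¹) := by
    refine ⟨fun _ _ => by positivity, fun _ _ => inv_le_one_of_one_le₀ (by exact_mod_cast hk),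
      fun i => ?_⟩
    induction i with | _ x y
    rw [Finset.sum_const, nsmul_eq_mul, ← div_eq_mul_inv, div_le_one hk0, Nat.cast_le]
    have hsub : (({e ∈ E | cl e = s(x, y)} : Finset ℕ) : Set ℕ) ⊆ {e | G.IsLink e x y} := by
      intro e he
      obtain ⟨heE, hec⟩ := Finset.mem_filter.1 (Finset.mem_coe.1 he)
      obtain ⟨x', y', h⟩ := G.exists_isLink_of_mem_edgeSet (by simpa [hEdef] using heE)
      exact h.isLink_iff_sym2_eq.2 ((hcl e x' y' h).symm.trans hec)
    have := (Set.encard_le_encard hsub).trans (hmult x y)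
    rw [Set.encard_coe_eq_coe_finsetCard] at this
    exact_mod_cast this
  have hsum : ∑ e ∈ E, (fun _ => (k : ℝ)⁻¹) e = (m : ℝ) / k := by
    rw [Finset.sum_const, hEcard, nsmul_eq_mul, div_eq_mul_inv]
  obtain ⟨T, hT, T', hT', h1, h2, h3, h4, h5⟩ := hp.exists_rounding (C := C)
    (a := fun z => (d z).1) (b := fun z => (d z).2) fun z hz => (hd z hz).2
  rw [hsum] at h3 h4 h5
  -- Edges with distinct pairs of ends form a simple graph, drawn by restriction; its crossings are
  -- among those with both edges in `S`.
  have hbound : ∀ S ⊆ E, Set.InjOn cl (S : Set ℕ) → ∀ l : ℕ, S.card = l →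
      crSimple n l ≤ (({z ∈ C | (d z).1 ∈ S ∧ (d z).2 ∈ S} : Finset _).card : ℕ) := by
    intro S hS hinj l hl
    refine (crSimple_le_encard hV D (T := S) (fun e he => ?_)
      (by rw [Set.encard_coe_eq_coe_finsetCard, hl])
      (Graph.simple_restrict hloop hcl hinj)).trans ?_
    · have := hS (Finset.mem_coe.1 he)
      simpa [hEdef] using this
    · rw [← Set.encard_coe_eq_coe_finsetCard]
      refine Set.encard_le_encard fun z hz => ?_
      have hzC : z ∈ C := by simpa [hCdef] using hz.1
      have hz1 := (hd z hzC).1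
      refine Finset.mem_coe.2 (Finset.mem_filter.2 ⟨hzC, hz.2 _ ?_, hz.2 _ ?_⟩)
      · rw [hz1]; exact Sym2.mem_mk_left _ _
      · rw [hz1]; exact Sym2.mem_mk_right _ _
  refine ⟨_, _, hbound T hT h1 _ h3, hbound T' hT' h2 _ h4, ?_⟩
  refine (mul_le_mul_of_nonneg_left h5 (by positivity)).trans ?_
  rw [pairSum, Finset.sum_const, nsmul_eq_mul, Set.ncard_eq_toFinset_card _ hCfin]
  field_simp
  exact le_rfl

/-- If `crMulti n m k` is finite, then a drawing bounds both values of `crSimple` by natural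
numbers, and the inequality reduces to one between real numbers. -/
lemma le_crMulti {n m k : ℕ} (hk : 1 ≤ k) :
    (k : ℝ≥0∞) ^ 2 *
        (ENNReal.ofReal (1 - Int.fract ((m : ℝ) / k)) * (crSimple n ⌊(m : ℝ) / k⌋₊ : ℝ≥0∞) +
          ENNReal.ofReal (Int.fract ((m : ℝ) / k)) * (crSimple n ⌈(m : ℝ) / k⌉₊ : ℝ≥0∞)) ≤
      (crMulti n m k : ℝ≥0∞) := by
  by_cases htop : crMulti n m k = ⊤
  · rw [htop]; simp
  obtain ⟨G, hV, hE, hloop, hmult, D, hD⟩ : ∃ G : Graph ℕ ℕ, G.vertexSet.encard = n ∧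
      G.edgeSet.encard = m ∧ G.Loopless ∧ G.MultiplicityLE k ∧
      ∃ D : G.Drawing, D.crossings.encard ≤ crMulti n m k := by
    have hlt : crMulti n m k < crMulti n m k + 1 := ENat.lt_add_one_iff htop |>.2 le_rfl
    obtain ⟨⟨G, hV, hE, hloop, hmult⟩, hG⟩ := iInf_lt_iff.1 hlt
    obtain ⟨D, hD⟩ := iInf_lt_iff.1 hG
    exact ⟨G, hV, hE, hloop, hmult, D, (ENat.lt_add_one_iff htop).1 hD⟩
  obtain ⟨A, B, hA, hB, h⟩ := exists_rounding_of_drawing hk hV hE hloop hmult D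
  have hCfin := D.finite_crossings (Set.finite_of_encard_eq_coe hE)
  have hfr0 := Int.fract_nonneg ((m : ℝ) / k)
  have hfr1 := (Int.fract_lt_one ((m : ℝ) / k)).le
  set r := Int.fract ((m : ℝ) / k)
  calc _ ≤ (k : ℝ≥0∞) ^ 2 * (ENNReal.ofReal (1 - r) * ((A : ℕ∞) : ℝ≥0∞) +
        ENNReal.ofReal r * ((B : ℕ∞) : ℝ≥0∞)) := by gcongr
    _ = ENNReal.ofReal ((k : ℝ) ^ 2 * ((1 - r) * A + r * B)) := by
        have h1 : 0 ≤ 1 - r := by linarith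
        rw [ENNReal.ofReal_mul (by positivity), ENNReal.ofReal_add (by positivity) (by positivity),
          ENNReal.ofReal_mul h1, ENNReal.ofReal_mul hfr0, ENNReal.ofReal_pow (by positivity)]
        simp
    _ ≤ ENNReal.ofReal D.crossings.ncard := ENNReal.ofReal_le_ofReal h
    _ = ((D.crossings.encard : ℕ∞) : ℝ≥0∞) := by
        rw [← hCfin.cast_ncard_eq, ENNReal.ofReal_natCast]; simp
    _ ≤ _ := by gcongr

theorem mainTheorem2 (n m k : ℕ) (hk : 1 ≤ k) :
    ((k : ℕ∞) ^ 2 * crSimple n ⌊(m : ℝ) / k⌋₊ ≤ crMulti n m k ∧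
      crMulti n m k ≤ (k : ℕ∞) ^ 2 * crSimple n ⌈(m : ℝ) / k⌉₊) ∧
    (k : ℝ≥0∞) ^ 2 *
        (ENNReal.ofReal (1 - Int.fract ((m : ℝ) / k)) * (crSimple n ⌊(m : ℝ) / k⌋₊ : ℝ≥0∞) +
          ENNReal.ofReal (Int.fract ((m : ℝ) / k)) * (crSimple n ⌈(m : ℝ) / k⌉₊ : ℝ≥0∞)) ≤
      (crMulti n m k : ℝ≥0∞) := by
  refine ⟨⟨?_, crMulti_le n m k hk⟩, le_crMulti hk⟩
  have h := le_crMulti (n := n) (m := m) hk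
  have hmono : (crSimple n ⌊(m : ℝ) / k⌋₊ : ℝ≥0∞) ≤ (crSimple n ⌈(m : ℝ) / k⌉₊ : ℝ≥0∞) :=
    ENat.toENNReal_le.2 (crSimple_mono n (Nat.floor_le_ceil _))
  have hfr0 := Int.fract_nonneg ((m : ℝ) / k)
  have hfr1 := (Int.fract_lt_one ((m : ℝ) / k)).le
  rw [← ENat.toENNReal_le]
  refine le_trans ?_ h
  rw [ENat.toENNReal_mul, ENat.toENNReal_pow, ENat.toENNReal_coe]
  gcongr
  -- By monotonicity, the value at the floor is at most any weighted mean of the values at the floor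
  -- and at the ceiling.
  calc (crSimple n ⌊(m : ℝ) / k⌋₊ : ℝ≥0∞)
      = (ENNReal.ofReal (1 - Int.fract ((m : ℝ) / k)) +
          ENNReal.ofReal (Int.fract ((m : ℝ) / k))) * (crSimple n ⌊(m : ℝ) / k⌋₊ : ℝ≥0∞) := by
        rw [← ENNReal.ofReal_add (by linarith) hfr0]; simp
    _ ≤ _ := by rw [add_mul]; gcongr
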